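/- Let $\mathbb{T}\subseteq\mathbb{R}$ be a time scale (a nonempty closed set) with forward jump operator $\sigma$, let $A\in\mathbb{R}^{n\times n}$ and $B\in\mathbb{R}^{n\times m}$ with columns $b_1,\dots,b_m$, and consider the system $x^\Delta(t)=Ax(t)+Bu(t)$ on $\mathbb{T}$, where $x^\Delta$ is the delta derivative. A control on $[t_0,t_1)_{\mathbb{T}}=[t_0,t_1)\cap\mathbb{T}$ is a function with finitely many discontinuities, at each of which it is right-continuous and, if the point is left-dense, has a finite left-sided limit. A trajectory on $[t_0,t_1]_{\mathbb{T}}$ is continuous and satisfies the equation on $[t_0,t_1)_{\mathbb{T}}$, with the forward delta derivative at the discontinuities of $u$. Assume that the system is positive: whenever $x(t_0)\in\mathbb{R}^n_+$ and the control takes values in $\mathbb{R}^m_+$, the trajectory stays in $\mathbb{R}^n_+$. Let $e_A(\cdot,s)$ be the forward solution of $X^\Delta=AX$, $X(s)=I$, on $[s,\infty)_{\mathbb{T}}$. Call a square matrix monomial if each of its rows and each of its columns has exactly one positive entry and all its other entries are zero. Let $t_0<t_1$ be elements of $\mathbb{T}$. Suppose that there is a set $M\subseteq\{1,\dots,m\}$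 such that the matrix $$W_{t_0}^{t_1}(M)=\int_{t_0}^{t_1}e_A(t_1,\sigma(\tau))\,\tilde B\tilde B^{T}e_A(t_1,\sigma(\tau))^{T}\,\Delta\tau$$ is monomial, where $\tilde B$ is the submatrix of $B$ consisting of the columns $b_k$, $k\in M$, and $\int\cdots\Delta\tau$ is the delta integral (the increment of an antiderivative with respect to the delta derivative), taken entrywise. Then the system is positively reachable on $[t_0,t_1]_{\mathbb{T}}$: the set of all $x(t_1)$, where $x$ is a trajectory with $x(t_0)=0$ for a control $u:[t_0,t_1)_{\mathbb{T}}\to\mathbb{R}^m_+$, equals $\mathbb{R}^n_+$. In particular, the same conclusion holds if the matrix $W_{t_0}^{t_1}=\int_{t_0}^{t_1}e_A(t_1,\sigma(\tau))BB^{T}e_A(t_1,\sigma(\tau))^{T}\Delta\tau$ is monomial. -/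

import Mathlib

open Filter Topology Matrix

noncomputable section

namespace TimeScale

/-- The forward jump operator of the time scale `T`. -/
def forwardJump (T : Set ℝ) (t : ℝ) : ℝ :=
  open Classical in if ∃ s ∈ T, t < s then sInf {s | s ∈ T ∧ t < s} else t

/-- The backward jump operator of the time scale `T`. -/
def backwardJump (T : Set ℝ) (t : ℝ) : ℝ :=
  open Classical in if ∃ s ∈ T, s < t then sSup {s | s ∈ T ∧ s < t} else t

/-- `t` is left-dense in `T`: it is not the minimum of `T` and the backward jump fixes it. -/
def LeftDense (T : Set ℝ) (t : ℝ) : Prop :=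
  (∃ s ∈ T, s < t) ∧ backwardJump T t = t

/-- The set of points of `T` that are nonmaximal or left-dense. -/
def kappa (T : Set ℝ) : Set ℝ :=
  {t | t ∈ T ∧ ((∃ s ∈ T, t < s) ∨ LeftDense T t)}

/-- `d` is the delta derivative at `t` of `f`, on the time scale `T`. Only the values of `f` on `T`
matter. -/
def HasDeltaDerivAt (T : Set ℝ) (f : ℝ → ℝ) (d t : ℝ) : Prop :=
  ∀ ε > 0, ∃ δ > 0, ∀ s ∈ T, |s - t| < δ →
    |f (forwardJump T t) - f s - d * (forwardJump T t - s)| ≤ ε * |forwardJump T t - s|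

/-- `F` is an antiderivative of `f` on the interval `[a, b]` of the time scale `T`. As `f` need only
be defined on `[a, b)`, the equation is imposed on `[a, b)` and `F` is continuous up to `b`. -/
def IsAntiderivOn (T : Set ℝ) (f : ℝ → ℝ) (a b : ℝ) (F : ℝ → ℝ) : Prop :=
  ContinuousOn F (T ∩ Set.Icc a b) ∧
    ∀ t ∈ T ∩ Set.Ico a b, HasDeltaDerivAt (T ∩ Set.Icc a b) F (f t) t

/-- The delta integral of `f` over `[a, b)`, as the increment `F b - F a` of an antiderivative `F`
(and `0` when there is none). -/
def deltaIntegral (T : Set ℝ) (f : ℝ → ℝ) (a b : ℝ) : ℝ :=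
  open Classical in
  if h : ∃ F, IsAntiderivOn T f a b F then h.choose b - h.choose a else 0

/-- `X` is a forward solution, on `[t₀, ∞)` in `T`, of the matrix equation `X^Δ = A X`,
`X(t₀) = I`. -/
def IsMatrixExp {n : ℕ} (T : Set ℝ) (A : Matrix (Fin n) (Fin n) ℝ) (t₀ : ℝ)
    (X : ℝ → Matrix (Fin n) (Fin n) ℝ) : Prop :=
  X t₀ = 1 ∧ ∀ t ∈ kappa (T ∩ Set.Ici t₀), ∀ i j,
    HasDeltaDerivAt (T ∩ Set.Ici t₀) (fun s => X s i j) ((A * X t) i j) t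

/-- The matrix exponential `e_A(t, t₀)`: the value at `t` of the forward solution of `X^Δ = A X`,
`X(t₀) = I`. It is meant for `t₀ ≤ t`, both in `T`. -/
def matrixExp {n : ℕ} (T : Set ℝ) (A : Matrix (Fin n) (Fin n) ℝ) (t t₀ : ℝ) :
    Matrix (Fin n) (Fin n) ℝ :=
  Classical.epsilon (IsMatrixExp T A t₀) t

/-- Piecewise continuous controls on `[t₀, t₁)` in `T`: finitely many points of discontinuity, at
each of which `u` is right-continuous and has a finite left-sided limit (a void requirement at
points that cannot be approached from the left within the interval). -/
def IsControl {m : ℕ} (T : Set ℝ) (t₀ t₁ : ℝ) (u : ℝ → Fin m → ℝ) : Prop :=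
  {t | t ∈ T ∩ Set.Ico t₀ t₁ ∧ ¬ ContinuousWithinAt u (T ∩ Set.Ico t₀ t₁) t}.Finite ∧
    ∀ t ∈ T ∩ Set.Ico t₀ t₁, ¬ ContinuousWithinAt u (T ∩ Set.Ico t₀ t₁) t →
      ContinuousWithinAt u (T ∩ Set.Ico t t₁) t ∧
        ∃ l, Tendsto u (𝓝[T ∩ Set.Ico t₀ t] t) (𝓝 l)

/-- A control on `[t₀, t₁)` in `T` with values in the nonnegative orthant. -/
def IsNonnegControl {m : ℕ} (T : Set ℝ) (t₀ t₁ : ℝ) (u : ℝ → Fin m → ℝ) : Prop :=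
  IsControl T t₀ t₁ u ∧ ∀ t ∈ T ∩ Set.Ico t₀ t₁, 0 ≤ u t

/-- `x` is a trajectory on `[t₀, t₁]` in `T` of `x^Δ = A x + B u` for the control `u`. It is
continuous (at `t₁` too) and satisfies the equation at each point of `[t₀, t₁)` where `u` is
continuous. At the points where `u` jumps, the equation holds with the forward delta derivative,
i.e. the delta derivative on the time scale `[t, t₁]` that starts at the point `t`. -/
def IsTrajectory {n m : ℕ} (T : Set ℝ) (A : Matrix (Fin n) (Fin n) ℝ)
    (B : Matrix (Fin n) (Fin m) ℝ) (t₀ t₁ : ℝ) (u : ℝ → Fin m → ℝ) (x : ℝ → Fin n → ℝ) : Prop :=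
  ContinuousOn x (T ∩ Set.Icc t₀ t₁) ∧
    ∀ t ∈ T ∩ Set.Ico t₀ t₁,
      (∀ i, HasDeltaDerivAt (T ∩ Set.Icc t t₁) (fun s => x s i) ((A *ᵥ x t + B *ᵥ u t) i) t) ∧
      (ContinuousWithinAt u (T ∩ Set.Ico t₀ t₁) t →
        ∀ i, HasDeltaDerivAt (T ∩ Set.Icc t₀ t₁) (fun s => x s i)
          ((A *ᵥ x t + B *ᵥ u t) i) t)

/-- The system `x^Δ = A x + B u` on `T` is positive: nonnegative initial conditions and nonnegative
controls give nonnegative trajectories. -/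
def IsPositiveSystem {n m : ℕ} (T : Set ℝ) (A : Matrix (Fin n) (Fin n) ℝ)
    (B : Matrix (Fin n) (Fin m) ℝ) : Prop :=
  ∀ t₀ ∈ T, ∀ t₁ ∈ T, ∀ u x, IsNonnegControl T t₀ t₁ u → IsTrajectory T A B t₀ t₁ u x →
    0 ≤ x t₀ → ∀ t ∈ T ∩ Set.Icc t₀ t₁, 0 ≤ x t

/-- The positive reachable set from `0` on `[t₀, t₁]` in `T`. -/
def positiveReachableSet {n m : ℕ} (T : Set ℝ) (A : Matrix (Fin n) (Fin n) ℝ)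
    (B : Matrix (Fin n) (Fin m) ℝ) (t₀ t₁ : ℝ) : Set (Fin n → ℝ) :=
  {z | ∃ u x, IsNonnegControl T t₀ t₁ u ∧ IsTrajectory T A B t₀ t₁ u x ∧ x t₀ = 0 ∧ x t₁ = z}

/-- Positive reachability on `[t₀, t₁]` in `T`. -/
def PositivelyReachableOn {n m : ℕ} (T : Set ℝ) (A : Matrix (Fin n) (Fin n) ℝ)
    (B : Matrix (Fin n) (Fin m) ℝ) (t₀ t₁ : ℝ) : Prop :=
  positiveReachableSet T A B t₀ t₁ = {z | 0 ≤ z}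

/-- A monomial vector: one component is positive and all the others are zero. -/
def IsMonomialVec {n : ℕ} (v : Fin n → ℝ) : Prop :=
  ∃ k, 0 < v k ∧ ∀ i, i ≠ k → v i = 0

/-- A monomial matrix: all rows and all columns are monomial. -/
def IsMonomialMatrix {n : ℕ} (W : Matrix (Fin n) (Fin n) ℝ) : Prop :=
  (∀ i, IsMonomialVec (fun j => W i j)) ∧ ∀ j, IsMonomialVec (fun i => W i j)

/-- The Gram matrix `∫ e_A(t₁, σ(τ)) C Cᵀ e_A(t₁, σ(τ))ᵀ Δτ` over `[t₀, t₁)`, integrated entry by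
entry. -/
def gramMatrix {n : ℕ} {ι : Type*} [Fintype ι] (T : Set ℝ) (A : Matrix (Fin n) (Fin n) ℝ)
    (C : Matrix (Fin n) ι ℝ) (t₀ t₁ : ℝ) : Matrix (Fin n) (Fin n) ℝ :=
  Matrix.of fun i j => deltaIntegral T (fun τ =>
    (matrixExp T A t₁ (forwardJump T τ) * C * Cᵀ *
      (matrixExp T A t₁ (forwardJump T τ))ᵀ) i j) t₀ t₁

/-- The submatrix of `B` that consists of the columns with index in `M`. -/
def columns {n m : ℕ} (B : Matrix (Fin n) (Fin m) ℝ) (M : Finset (Fin m)) :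
    Matrix (Fin n) M ℝ :=
  B.submatrix id (fun k => (k : Fin m))

end TimeScale

end

/-! ### Jump operator, forward derivatives and monotonicity. -/

namespace TimeScale

variable {T : Set ℝ} {t s a b : ℝ}

/-! Put `Φ(s) = e_A(t₁, σ(s)) C`, where `C` consists of the chosen columns of `B`. Positivity of the
system makes `e_A(t₁, ·)` and `B` entrywise nonnegative (`matrixExp_nonneg`, `input_nonneg`), so the
integrand `∑ k, Φ i k * Φ j k` of each Gram entry is a sum of nonnegative terms. A delta
antiderivative satisfies its equation at every point of `[t₀, t₁)`, so one positive value of the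
integrand already makes the entry positive (`deltaIntegral_pos`).

Row `i` of the Gram matrix has a positive entry, hence `Φ i k > 0` at some time `τ` for some `k`.
Then the diagonal entry is positive, the other entries of the row vanish, and `Φ i k * Φ j k = 0` at
every time for all `j ≠ i` (`exists_column_of_isMonomialMatrix`). Thus input `k`, switched on only
while `Φ i k > 0`, moves coordinate `i` of the final state and no other. Positivity of `Φ i k`
persists on some `[τ, τ')`, so a constant pulse there works. A sum of such pulses, one per
coordinate with weights `c i ≥ 0`, ends at a state whose coordinate `i` is `c i` times a positive
gain; the weights can be chosen to hit any nonnegative target.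

The analytic basis is variation of constants (`IsTrajectory.hasForwardDerivAt_matrixExp_mulVec`).
Since `1 + μ A` may be singular, `e_A` need not be invertible and is used only forward in time: its
continuity in the initial time comes from the semigroup identity and a Grönwall bound. Existence of
solutions and antiderivatives is reduced to Lebesgue integrals over the real line, of integrands
that are constant on the gaps of `T`. -/

theorem bddBelow_gt (T : Set ℝ) (t : ℝ) : BddBelow {s | s ∈ T ∧ t < s} :=
  ⟨t, fun _ hs => hs.2.le⟩

theorem forwardJump_le (hs : s ∈ T) (hts : t < s) : forwardJump T t ≤ s := by
  rw [forwardJump, if_pos ⟨s, hs, hts⟩]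
  exact csInf_le (bddBelow_gt T t) ⟨hs, hts⟩

theorem le_forwardJump (T : Set ℝ) (t : ℝ) : t ≤ forwardJump T t := by
  rw [forwardJump]
  split_ifs with h
  · obtain ⟨s, hs, hts⟩ := h
    exact le_csInf ⟨s, hs, hts⟩ fun r hr => hr.2.le
  · exact le_rfl

theorem forwardJump_mem (hT : IsClosed T) (h : ∃ s ∈ T, t < s) : forwardJump T t ∈ T := by
  obtain ⟨s, hs, hts⟩ := h
  rw [forwardJump, if_pos ⟨s, hs, hts⟩]
  exact closure_minimal (fun r hr => hr.1) hT
    (csInf_mem_closure ⟨s, hs, hts⟩ (bddBelow_gt T t))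

theorem forwardJump_mem_of_mem (hT : IsClosed T) (ht : t ∈ T) : forwardJump T t ∈ T := by
  by_cases h : ∃ s ∈ T, t < s
  · exact forwardJump_mem hT h
  · rwa [forwardJump, if_neg h]

theorem forwardJump_mono (T : Set ℝ) : Monotone (forwardJump T) := by
  intro t t' htt'
  by_cases h : ∃ s ∈ T, t' < s
  · rw [forwardJump, forwardJump, if_pos h, if_pos (h.imp fun s hs => ⟨hs.1, htt'.trans_lt hs.2⟩)]
    obtain ⟨s, hs, hts⟩ := h
    exact csInf_le_csInf (bddBelow_gt T t) ⟨s, hs, hts⟩ fun r hr => ⟨hr.1, htt'.trans_lt hr.2⟩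
  · by_cases h' : ∃ s ∈ T, t < s
    · obtain ⟨s, hs, hts⟩ := h'
      refine (forwardJump_le hs hts).trans (le_trans ?_ (le_forwardJump T t'))
      by_contra! hc
      exact h ⟨s, hs, hc⟩
    · rw [forwardJump, if_neg h']
      exact htt'.trans (le_forwardJump T t')

/-- The jump operator is local: it depends only on the points of the time scale just above `t`. -/
theorem forwardJump_congr {S : Set ℝ} (hb : b ∈ T) (htb : t < b)
    (hS : ∀ s, t < s → s ≤ b → (s ∈ S ↔ s ∈ T)) : forwardJump S t = forwardJump T t := by
  have hbS : b ∈ S := (hS b htb le_rfl).2 hb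
  rw [forwardJump, forwardJump, if_pos ⟨b, hbS, htb⟩, if_pos ⟨b, hb, htb⟩]
  apply le_antisymm
  · refine le_csInf ⟨b, hb, htb⟩ fun s hs => ?_
    rcases le_total s b with h | h
    · exact csInf_le (bddBelow_gt S t) ⟨(hS s hs.2 h).2 hs.1, hs.2⟩
    · exact (csInf_le (bddBelow_gt S t) ⟨hbS, htb⟩).trans h
  · refine le_csInf ⟨b, hbS, htb⟩ fun s hs => ?_
    rcases le_total s b with h | h
    · exact csInf_le (bddBelow_gt T t) ⟨(hS s hs.2 h).1 hs.1, hs.2⟩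
    · exact (csInf_le (bddBelow_gt T t) ⟨hb, htb⟩).trans h

/-- The filter of points of `T` just after `t`: the point `σ(t)` when `t` is right-scattered, and
the punctured right neighbourhoods of `t` within `T` otherwise. -/
noncomputable def nextFilter (T : Set ℝ) (t : ℝ) : Filter ℝ :=
  open Classical in if t < forwardJump T t then pure (forwardJump T t) else 𝓝[T ∩ Set.Ioi t] t

theorem eventually_nextFilter (hT : IsClosed T) (hb : b ∈ T) (htb : t < b) :
    ∀ᶠ s in nextFilter T t, s ∈ T ∧ t < s ∧ s ≤ b := by
  rw [nextFilter]
  split_ifs with h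
  · exact eventually_pure.2 ⟨forwardJump_mem hT ⟨b, hb, htb⟩, h, forwardJump_le hb htb⟩
  · filter_upwards [self_mem_nhdsWithin, mem_nhdsWithin_of_mem_nhds (Iio_mem_nhds htb)] with s h1 h2
    exact ⟨h1.1, h1.2, le_of_lt h2⟩

theorem nextFilter_neBot (hb : b ∈ T) (htb : t < b) : (nextFilter T t).NeBot := by
  rw [nextFilter]
  split_ifs with h
  · infer_instance
  · rw [← mem_closure_iff_nhdsWithin_neBot, Metric.mem_closure_iff]
    intro ε hε
    have h1 : forwardJump T t < t + ε := by linarith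
    rw [forwardJump, if_pos ⟨b, hb, htb⟩] at h1
    obtain ⟨s, hs, hsε⟩ := exists_lt_of_csInf_lt (s := {s | s ∈ T ∧ t < s}) ⟨b, hb, htb⟩ h1
    refine ⟨s, hs, ?_⟩
    rw [dist_comm, Real.dist_eq, abs_lt]
    constructor <;> linarith [hs.2]

theorem tendsto_nextFilter {E : Type*} [TopologicalSpace E] {w : ℝ → E} {S : Set ℝ}
    (htb : t < b) (hS : ∀ s, t < s → s ≤ b → s ∈ T → s ∈ S)
    (hw : ContinuousWithinAt w S t) :
    Tendsto w (nextFilter T t) (𝓝 (w (forwardJump T t))) := by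
  rw [nextFilter]
  split_ifs with h
  · exact tendsto_pure_nhds _ _
  · have h1 : forwardJump T t = t := le_antisymm (not_lt.1 h) (le_forwardJump T t)
    rw [h1]
    refine Tendsto.mono_left hw (nhdsWithin_le_iff.2 ?_)
    filter_upwards [self_mem_nhdsWithin, mem_nhdsWithin_of_mem_nhds (Iio_mem_nhds htb)] with s h2 h3
    exact hS s h2.2 (le_of_lt h3) h2.1

/-- `d` is the forward delta derivative of `f` at `t`, as the limit of difference quotients. -/
noncomputable def HasForwardDerivAt (T : Set ℝ) (f : ℝ → ℝ) (d t : ℝ) : Prop :=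
  Tendsto (fun s => (f s - f t) / (s - t)) (nextFilter T t) (𝓝 d)

theorem HasForwardDerivAt.const_mul {f : ℝ → ℝ} {d : ℝ} (c : ℝ) (hf : HasForwardDerivAt T f d t) :
    HasForwardDerivAt T (fun s => c * f s) (c * d) t :=
  (Tendsto.const_mul c hf).congr fun s => by ring

theorem HasForwardDerivAt.neg {f : ℝ → ℝ} {d : ℝ} (hf : HasForwardDerivAt T f d t) :
    HasForwardDerivAt T (fun s => - f s) (- d) t :=
  (Tendsto.neg hf).congr fun s => by ring

theorem HasForwardDerivAt.sub {f g : ℝ → ℝ} {d e : ℝ} (hf : HasForwardDerivAt T f d t)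
    (hg : HasForwardDerivAt T g e t) : HasForwardDerivAt T (fun s => f s - g s) (d - e) t :=
  (Tendsto.sub hf hg).congr fun s => by ring

theorem HasForwardDerivAt.sum {ι : Type*} {I : Finset ι} {f : ι → ℝ → ℝ} {d : ι → ℝ}
    (hf : ∀ i ∈ I, HasForwardDerivAt T (f i) (d i) t) :
    HasForwardDerivAt T (fun s => ∑ i ∈ I, f i s) (∑ i ∈ I, d i) t := by
  refine (tendsto_finsetSum I hf).congr fun s => ?_
  rw [← Finset.sum_div, Finset.sum_sub_distrib]

/-- Product rule at a zero of the second factor. -/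
theorem HasForwardDerivAt.mul_of_eq_zero {w v : ℝ → ℝ} {d l : ℝ} (hv : HasForwardDerivAt T v d t)
    (h0 : v t = 0) (hw : Tendsto w (nextFilter T t) (𝓝 l)) :
    HasForwardDerivAt T (fun s => w s * v s) (l * d) t := by
  refine (Tendsto.mul hw hv).congr fun s => ?_
  simp only [h0]
  ring

/-- On a time scale, the increments of `f` are dominated by those of `g` when the forward delta
derivative of `f` is dominated by difference quotients of `g`. -/
theorem sub_le_sub_of_hasForwardDerivAt (hT : IsClosed T) (ha : a ∈ T) (hb : b ∈ T) (hab : a ≤ b)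
    {f g D : ℝ → ℝ} (hf : ContinuousOn f (T ∩ Set.Icc a b)) (hg : ContinuousOn g (T ∩ Set.Icc a b))
    (hfd : ∀ t ∈ T ∩ Set.Ico a b, ∃ d ≤ D t, HasForwardDerivAt T f d t)
    (hgd : ∀ t ∈ T ∩ Set.Ico a b, ∀ s ∈ T, t < s → D t * (s - t) ≤ g s - g t) :
    f b - f a ≤ g b - g a := by
  refine le_of_forall_pos_le_add fun η hη => ?_
  obtain ⟨ε, hε, hεη⟩ : ∃ ε > 0, ε * (b - a) ≤ η := by
    refine ⟨η / (b - a + 1), by have := sub_nonneg.2 hab; positivity, ?_⟩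
    have := sub_nonneg.2 hab
    rw [div_mul_eq_mul_div, div_le_iff₀ (by positivity)]
    nlinarith
  have hK : IsCompact (T ∩ Set.Icc a b) := isCompact_Icc.inter_left hT
  -- Real induction by compactness: the greatest `c` in this set must be `b`, because at `c < b` the
  -- forward derivative yields a later point that still satisfies the inequality. The slack `ε`
  -- absorbs the error of the difference quotient.
  have hP : IsCompact {t ∈ T ∩ Set.Icc a b | f t - g t - ε * t ≤ f a - g a - ε * a} := by
    have hc : ContinuousOn (fun t => f t - g t - ε * t) (T ∩ Set.Icc a b) := by fun_prop
    exact hK.of_isClosed_subset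
      (hc.preimage_isClosed_of_isClosed hK.isClosed isClosed_Iic) fun t ht => ht.1
  obtain ⟨c, ⟨⟨hcT, hac, hcb⟩, hc⟩, hmax⟩ :=
    hP.exists_isGreatest ⟨a, ⟨ha, le_rfl, hab⟩, le_rfl⟩
  rcases hcb.eq_or_lt with rfl | hcb
  · linarith
  exfalso
  obtain ⟨d, hdD, hd⟩ := hfd c ⟨hcT, hac, hcb⟩
  have hne := nextFilter_neBot hb hcb
  obtain ⟨s, hs, hsT, hcs, hsb⟩ := ((hd.eventually (Iio_mem_nhds (show d < d + ε by linarith))).and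
    (eventually_nextFilter hT hb hcb)).exists
  have h1 : (f s - f c) / (s - c) < d + ε := hs
  rw [div_lt_iff₀ (by linarith)] at h1
  have h2 := hgd c ⟨hcT, hac, hcb⟩ s hsT hcs
  have h3 : d * (s - c) ≤ D c * (s - c) := mul_le_mul_of_nonneg_right hdD (by linarith)
  have := hmax ⟨⟨hsT, hac.trans hcs.le, hsb⟩, by linarith⟩
  linarith

theorem le_of_hasForwardDerivAt_nonneg (hT : IsClosed T) (ha : a ∈ T) (hb : b ∈ T) (hab : a ≤ b)
    {f : ℝ → ℝ} (hf : ContinuousOn f (T ∩ Set.Icc a b))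
    (hfd : ∀ t ∈ T ∩ Set.Ico a b, ∃ d, 0 ≤ d ∧ HasForwardDerivAt T f d t) : f a ≤ f b := by
  have := sub_le_sub_of_hasForwardDerivAt (f := fun t => - f t) (g := fun _ => 0) (D := fun _ => 0)
    hT ha hb hab hf.neg continuousOn_const
    (fun t ht => (hfd t ht).elim fun d hd => ⟨-d, by linarith [hd.1], hd.2.neg⟩)
    (fun t _ s _ _ => by simp)
  linarith

theorem eq_of_hasForwardDerivAt_zero (hT : IsClosed T) (ha : a ∈ T) (hb : b ∈ T) (hab : a ≤ b)
    {f : ℝ → ℝ} (hf : ContinuousOn f (T ∩ Set.Icc a b))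
    (hfd : ∀ t ∈ T ∩ Set.Ico a b, HasForwardDerivAt T f 0 t) : f a = f b := by
  apply le_antisymm
  · exact le_of_hasForwardDerivAt_nonneg hT ha hb hab hf fun t ht => ⟨0, le_rfl, hfd t ht⟩
  · have := le_of_hasForwardDerivAt_nonneg (f := fun s => - f s) hT ha hb hab hf.neg
      fun t ht => ⟨0, le_rfl, by simpa using (hfd t ht).neg⟩
    linarith

/-- A positive derivative at the single point `c` gives some `s > c` with `f c < f s`, and `f` is
nondecreasing from `a` to `c` and from `s` to `b`. -/
theorem lt_of_hasForwardDerivAt (hT : IsClosed T) (ha : a ∈ T) (hb : b ∈ T) 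
    {f d : ℝ → ℝ} (hf : ContinuousOn f (T ∩ Set.Icc a b))
    (hd : ∀ t ∈ T ∩ Set.Ico a b, 0 ≤ d t)
    (hfd : ∀ t ∈ T ∩ Set.Ico a b, HasForwardDerivAt T f (d t) t) {c : ℝ}
    (hc : c ∈ T ∩ Set.Ico a b) (hdc : 0 < d c) : f a < f b := by
  obtain ⟨hcT, hac, hcb⟩ := hc
  have hne := nextFilter_neBot hb hcb
  obtain ⟨s, hs, hsT, hcs, hsb⟩ := (((hfd c ⟨hcT, hac, hcb⟩).eventually (Ioi_mem_nhds hdc)).and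
    (eventually_nextFilter hT hb hcb)).exists
  have h1 : 0 < (f s - f c) / (s - c) := hs
  have h2 : 0 < f s - f c := by
    have := mul_pos h1 (sub_pos.2 hcs)
    rwa [div_mul_cancel₀ _ (sub_pos.2 hcs).ne'] at this
  have h3 : f a ≤ f c := le_of_hasForwardDerivAt_nonneg hT ha hcT hac
    (hf.mono fun r hr => ⟨hr.1, hr.2.1, hr.2.2.trans hcb.le⟩)
    fun r hr => ⟨d r, hd r ⟨hr.1, hr.2.1, hr.2.2.trans hcb⟩, hfd r ⟨hr.1, hr.2.1, hr.2.2.trans hcb⟩⟩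
  have h4 : f s ≤ f b := le_of_hasForwardDerivAt_nonneg hT hsT hb hsb
    (hf.mono fun r hr => ⟨hr.1, (hac.trans hcs.le).trans hr.2.1, hr.2.2⟩)
    fun r hr => ⟨d r, hd r ⟨hr.1, (hac.trans hcs.le).trans hr.2.1, hr.2.2⟩,
      hfd r ⟨hr.1, (hac.trans hcs.le).trans hr.2.1, hr.2.2⟩⟩
  linarith

/-- Testing the definition at `s = t` bounds a fixed quantity by `ε` times the gap length for every
`ε`. -/
theorem HasDeltaDerivAt.forwardJump_eq {f : ℝ → ℝ} {d : ℝ} (h : HasDeltaDerivAt T f d t)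
    (ht : t ∈ T) : f (forwardJump T t) - f t = d * (forwardJump T t - t) := by
  by_contra hne
  rcases (le_forwardJump T t).eq_or_lt with h0 | h0
  · rw [← h0] at hne
    simp at hne
  have hpos : 0 < |f (forwardJump T t) - f t - d * (forwardJump T t - t)| :=
    abs_pos.2 (sub_ne_zero.2 hne)
  have hμ : 0 < forwardJump T t - t := sub_pos.2 h0
  obtain ⟨δ, hδ, H⟩ := h (|f (forwardJump T t) - f t - d * (forwardJump T t - t)| /
    (2 * (forwardJump T t - t))) (by positivity)
  have h1 := H t ht (by simpa using hδ)
  rw [abs_of_pos hμ] at h1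
  field_simp at h1
  linarith

/-- With the exact jump relation inserted, the defining estimate controls `f s - f t - d (s - t)` by
a small multiple of the distance from `s` to `σ(t)`, which is at most `μ + 1` near `t`. -/
theorem HasDeltaDerivAt.continuousWithinAt {f : ℝ → ℝ} {d : ℝ} (h : HasDeltaDerivAt T f d t)
    (ht : t ∈ T) : ContinuousWithinAt f T t := by
  have hσ := h.forwardJump_eq ht
  set μ := forwardJump T t - t with hμ
  have hμ0 : 0 ≤ μ := sub_nonneg.2 (le_forwardJump T t)
  rw [Metric.continuousWithinAt_iff]
  intro ε hε
  obtain ⟨δ, hδ, H⟩ := h (ε / (2 * (μ + 1))) (by positivity)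
  refine ⟨min (min δ 1) (ε / (2 * (|d| + 1))), by positivity, fun s hs hst => ?_⟩
  rw [Real.dist_eq] at hst ⊢
  have h1 := lt_of_lt_of_le hst ((min_le_left _ _).trans (min_le_left _ _))
  have h2 := lt_of_lt_of_le hst ((min_le_left _ _).trans (min_le_right _ _))
  have h3 := lt_of_lt_of_le hst (min_le_right _ _)
  have h4 := H s hs h1
  have h5 : |forwardJump T t - s| ≤ μ + 1 := by
    have : forwardJump T t - s = μ - (s - t) := by rw [hμ]; ring
    rw [this]
    refine (abs_sub _ _).trans ?_
    rw [abs_of_nonneg hμ0]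
    linarith
  have h6 : f (forwardJump T t) - f s - d * (forwardJump T t - s) = d * (s - t) - (f s - f t) := by
    have : f (forwardJump T t) = f t + d * μ := by linarith
    rw [this, hμ]
    ring
  rw [h6] at h4
  have h7 : ε / (2 * (μ + 1)) * |forwardJump T t - s| ≤ ε / 2 := by
    calc _ ≤ ε / (2 * (μ + 1)) * (μ + 1) := by gcongr
      _ = ε / 2 := by field_simp
  have h8 : |d| * |s - t| < ε / 2 := by
    rw [lt_div_iff₀ (by positivity)] at h3
    nlinarith [abs_nonneg (s - t)]
  have h9 : |f s - f t| ≤ |d * (s - t)| + |d * (s - t) - (f s - f t)| := by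
    have := abs_sub_abs_le_abs_sub (f s - f t) (d * (s - t))
    rw [abs_sub_comm (f s - f t)] at this
    linarith
  rw [abs_mul] at h9
  linarith

/-- The hypotheses give derivatives on various restrictions of `T`, such as `[t, t₁]`, `[t₀, t₁]`
and `[s, ∞)`. A forward derivative sees only points just after `t`, so all of them can be expressed
on `T` itself. -/
theorem HasDeltaDerivAt.hasForwardDerivAt {S : Set ℝ} {f : ℝ → ℝ} {d : ℝ}
    (h : HasDeltaDerivAt S f d t) (ht : t ∈ S) (hb : b ∈ T) (htb : t < b)
    (hS : ∀ s, t < s → s ≤ b → (s ∈ S ↔ s ∈ T)) : HasForwardDerivAt T f d t := by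
  have hσ := h.forwardJump_eq ht
  have hj := forwardJump_congr hb htb hS
  rw [HasForwardDerivAt, nextFilter]
  split_ifs with h0
  · rw [tendsto_pure_left]
    intro U hU
    rw [← hj] at h0 ⊢
    rw [hσ, mul_div_cancel_right₀ _ (sub_pos.2 h0).ne']
    exact mem_of_mem_nhds hU
  · have h1 : forwardJump T t = t := le_antisymm (not_lt.1 h0) (le_forwardJump T t)
    rw [Metric.tendsto_nhds]
    intro ε hε
    obtain ⟨δ, hδ, H⟩ := h (ε / 2) (by positivity)
    filter_upwards [self_mem_nhdsWithin, mem_nhdsWithin_of_mem_nhds (Iio_mem_nhds htb),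
      mem_nhdsWithin_of_mem_nhds (Metric.ball_mem_nhds t hδ)] with s h2 h3 h4
    have h5 : t < s := h2.2
    have h6 := H s ((hS s h2.2 (le_of_lt h3)).2 h2.1) h4
    rw [hj, h1] at h6
    rw [Real.dist_eq]
    have h7 : (f s - f t) / (s - t) - d = (f t - f s - d * (t - s)) / (t - s) := by
      have : s - t ≠ 0 := by linarith
      have : t - s ≠ 0 := by linarith
      field_simp
      ring
    rw [h7, abs_div]
    have h8 : 0 < |t - s| := abs_pos.2 (by linarith)
    calc _ ≤ ε / 2 := by rwa [div_le_iff₀ h8]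
      _ < ε := by linarith

theorem HasDeltaDerivAt.mono {S : Set ℝ} {f : ℝ → ℝ} {d : ℝ} (h : HasDeltaDerivAt T f d t)
    (hST : S ⊆ T) (hj : forwardJump S t = forwardJump T t) : HasDeltaDerivAt S f d t := by
  intro ε hε
  obtain ⟨δ, hδ, H⟩ := h ε hε
  exact ⟨δ, hδ, fun s hs hst => by rw [hj]; exact H s (hST hs) hst⟩

end TimeScale

/-! ### Delta antiderivatives from Lebesgue integrals. -/

namespace TimeScale

open MeasureTheory in
theorem intervalIntegrable_of_norm_le {E : Type*} [NormedAddCommGroup E] {q : ℝ → E}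
    (hq : StronglyMeasurable q) {C a b : ℝ} (hC : ∀ s ∈ Set.uIcc a b, ‖q s‖ ≤ C) :
    IntervalIntegrable q volume a b := by
  rw [intervalIntegrable_iff]
  refine IntegrableOn.of_bound (by simp [Set.uIoc]) hq.aestronglyMeasurable C ?_
  filter_upwards [ae_restrict_mem measurableSet_uIoc] with s hs
  exact hC s (Set.uIoc_subset_uIcc hs)

theorem intervalIntegrable_comp_monotone {E : Type*} [NormedAddCommGroup E] {y : ℝ → E}
    (hy : Continuous y) {φ : ℝ → ℝ} (hφ : Monotone φ) (a b : ℝ) :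
    IntervalIntegrable (fun s => y (φ s)) MeasureTheory.volume a b := by
  obtain ⟨C, hC⟩ := (isCompact_Icc (a := φ (min a b)) (b := φ (max a b))).exists_bound_of_continuousOn
    hy.continuousOn
  exact intervalIntegrable_of_norm_le (hy.comp_stronglyMeasurable hφ.measurable.stronglyMeasurable)
    fun s hs => hC _ ⟨hφ hs.1, hφ hs.2⟩

-- The endpoints are null and must be left out: an integrand that is constant inside a gap may jump
-- at its right end.
open MeasureTheory in
theorem abs_integral_le_of_Ioo {q : ℝ → ℝ} {C s t : ℝ}
    (h : ∀ r ∈ Set.Ioo (min s t) (max s t), |q r| ≤ C) : |∫ r in s..t, q r| ≤ C * |t - s| := by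
  rw [← Real.norm_eq_abs]
  refine intervalIntegral.norm_integral_le_of_norm_le_const_ae ?_
  have h0 : ∀ᵐ r : ℝ, r ≠ max s t := by simp [ae_iff]
  filter_upwards [h0] with r hr hrI
  exact h r ⟨hrI.1, lt_of_le_of_ne hrI.2 hr⟩

/-- A fundamental theorem of calculus: a function whose increments on `S` are Lebesgue integrals of
`q` has the delta derivative `q t`, provided that `q` is constant on the gap after `t`, or is
continuous at a right-dense `t` when seen from points of `S`. -/
theorem hasDeltaDerivAt_of_integral {S : Set ℝ} {F q : ℝ → ℝ} {a C t : ℝ} (hS : IsClosed S)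
    (ht : t ∈ S) (hq : ∀ a b, IntervalIntegrable q MeasureTheory.volume a b)
    (hF : ∀ s ∈ S, F s = C + ∫ r in a..s, q r)
    (hgap : ∀ r, t < r → r < forwardJump S t → q r = q t)
    (hdense : forwardJump S t = t → ∀ ε > 0, ∃ δ > 0, ∀ s ∈ S, |s - t| < δ →
      ∀ r ∈ Set.Ioo (min s t) (max s t), |q r - q t| ≤ ε) :
    HasDeltaDerivAt S F (q t) t := by
  have hinc : ∀ s ∈ S, ∀ s' ∈ S, F s' - F s - q t * (s' - s) = ∫ r in s..s', (q r - q t) := by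
    intro s hs s' hs'
    rw [hF s hs, hF s' hs', intervalIntegral.integral_sub (hq _ _) intervalIntegrable_const,
      ← intervalIntegral.integral_interval_sub_left (hq a s') (hq a s)]
    simp
    ring
  have hσ := forwardJump_mem_of_mem hS ht
  intro ε hε
  rcases (le_forwardJump S t).eq_or_lt with h0 | h0
  · obtain ⟨δ, hδ, H⟩ := hdense h0.symm ε hε
    refine ⟨δ, hδ, fun s hs hst => ?_⟩
    rw [hinc s hs _ hσ, ← h0]
    exact abs_integral_le_of_Ioo (H s hs hst)
  · set σ := forwardJump S t
    have hgap0 : ∫ r in t..σ, (q r - q t) = 0 := by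
      have := abs_integral_le_of_Ioo (q := fun r => q r - q t) (C := 0) (s := t) (t := σ) (by
        rw [min_eq_left h0.le, max_eq_right h0.le]
        intro r hr
        rw [hgap r hr.1 hr.2]
        simp)
      simpa using this
    have hcont : Continuous fun s => ∫ r in s..t, (q r - q t) := by
      have : Continuous fun s => - ∫ r in t..s, (q r - q t) :=
        (intervalIntegral.continuous_primitive
          (fun a b => (hq a b).sub intervalIntegrable_const) t).neg
      refine this.congr fun s => ?_
      rw [intervalIntegral.integral_symm t s]
    -- The increment over the gap `[t, σ]` is exact, so only the integral from `s` to `t` remains.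
    -- It tends to `0` as `s → t`, whereas `|σ - s|` stays at least `(σ - t) / 2`.
    have hpos : 0 < ε * ((σ - t) / 2) := mul_pos hε (by linarith)
    obtain ⟨δ, hδ, H⟩ := Metric.continuousAt_iff.1 (hcont.continuousAt (x := t)) _ hpos
    refine ⟨min δ ((σ - t) / 2), lt_min hδ (by linarith), fun s hs hst => ?_⟩
    have h1 := H (lt_of_lt_of_le hst (min_le_left _ _))
    have h2 := lt_of_lt_of_le hst (min_le_right _ _)
    simp only [intervalIntegral.integral_same, Real.dist_eq, sub_zero] at h1
    have hq' : ∀ a b, IntervalIntegrable (fun r => q r - q t) MeasureTheory.volume a b :=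
      fun a b => (hq a b).sub intervalIntegrable_const
    rw [hinc s hs _ hσ, ← intervalIntegral.integral_add_adjacent_intervals (hq' s t) (hq' t σ),
      hgap0, add_zero]
    refine h1.le.trans (mul_le_mul_of_nonneg_left ?_ hε.le)
    rw [abs_lt] at h2
    exact le_trans (by linarith [h2.2]) (le_abs_self _)

/-- The last point of `T`, not before `a`, that does not exceed `s`. -/
noncomputable def floorPt (T : Set ℝ) (a s : ℝ) : ℝ := sSup (T ∩ Set.Icc a (max a s))

variable {T : Set ℝ} {a s t : ℝ}

theorem bddAbove_floorPt (T : Set ℝ) (a s : ℝ) : BddAbove (T ∩ Set.Icc a (max a s)) :=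
  ⟨max a s, fun _ hr => hr.2.2⟩

theorem floorPt_mem_inter (hT : IsClosed T) (ha : a ∈ T) (s : ℝ) :
    floorPt T a s ∈ T ∩ Set.Icc a (max a s) :=
  (hT.inter isClosed_Icc).csSup_mem ⟨a, ha, le_rfl, le_max_left _ _⟩ (bddAbove_floorPt T a s)

theorem le_floorPt (ht : t ∈ T) (hat : a ≤ t) (hts : t ≤ s) : t ≤ floorPt T a s :=
  le_csSup (bddAbove_floorPt T a s) ⟨ht, hat, hts.trans (le_max_right _ _)⟩

theorem floorPt_le (hT : IsClosed T) (ha : a ∈ T) (has : a ≤ s) : floorPt T a s ≤ s := by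
  simpa [has] using (floorPt_mem_inter hT ha s).2.2

theorem floorPt_self (hT : IsClosed T) (ha : a ∈ T) (ht : t ∈ T) (hat : a ≤ t) :
    floorPt T a t = t :=
  le_antisymm (floorPt_le hT ha hat) (le_floorPt ht hat le_rfl)

theorem floorPt_mono (ha : a ∈ T) : Monotone (floorPt T a) := fun _ s' h =>
  csSup_le_csSup (bddAbove_floorPt T a s') ⟨a, ha, le_rfl, le_max_left _ _⟩
    fun _ hr => ⟨hr.1, hr.2.1, hr.2.2.trans (max_le_max le_rfl h)⟩

/-- Existence of delta antiderivatives on a time scale `T ∩ I` starting at or after `a`. -/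
theorem hasDeltaDerivAt_of_integral_floorPt {I : Set ℝ} {F h : ℝ → ℝ} {C : ℝ} (hT : IsClosed T)
    (ha : a ∈ T) (hI : IsClosed I) (hIc : I.OrdConnected) (hIa : I ⊆ Set.Ici a) (ht : t ∈ T ∩ I)
    (hint : ∀ a' b', IntervalIntegrable (fun r => h (floorPt T a r)) MeasureTheory.volume a' b')
    (hF : ∀ s ∈ T ∩ I, F s = C + ∫ r in a..s, h (floorPt T a r))
    (hcont : ContinuousWithinAt h (T ∩ I) t) :
    HasDeltaDerivAt (T ∩ I) F (h t) t := by
  have hat : a ≤ t := hIa ht.2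
  have hft : floorPt T a t = t := floorPt_self hT ha ht.1 hat
  have hS : IsClosed (T ∩ I) := hT.inter hI
  have := hasDeltaDerivAt_of_integral hS ht hint hF (fun r htr hr => ?_) fun h0 ε hε => ?_
  · rwa [hft] at this
  · have h1 := le_floorPt ht.1 hat htr.le
    have h2 := floorPt_le hT ha (hat.trans htr.le)
    rcases h1.eq_or_lt with h3 | h3
    · rw [← h3, hft]
    · exfalso
      have h4 : floorPt T a r ∈ T ∩ I := ⟨(floorPt_mem_inter hT ha r).1,
        hIc.out ht.2 (forwardJump_mem_of_mem hS ht).2 ⟨h1, h2.trans hr.le⟩⟩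
      have := forwardJump_le h4 h3
      linarith
  · obtain ⟨δ, hδ, H⟩ := Metric.continuousWithinAt_iff.1 hcont ε hε
    refine ⟨δ, hδ, fun s hs hst r hr => ?_⟩
    have has : a ≤ s := hIa hs.2
    rw [hft]
    -- For `r` strictly between the scale points `s` and `t`, rounding down to `T` does not leave
    -- the interval between them, so continuity along `T ∩ I` controls the integrand on all of it.
    have hm : floorPt T a r ∈ Set.Icc (min s t) (max s t) := by
      constructor
      · rcases le_total s t with h1 | h1
        · rw [min_eq_left h1] at hr ⊢
          exact le_floorPt hs.1 has hr.1.le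
        · rw [min_eq_right h1] at hr ⊢
          exact le_floorPt ht.1 hat hr.1.le
      · exact (floorPt_le hT ha ((le_min has hat).trans hr.1.le)).trans hr.2.le
    have hmI : floorPt T a r ∈ T ∩ I := by
      refine ⟨(floorPt_mem_inter hT ha r).1, ?_⟩
      exact hIc.uIcc_subset hs.2 ht.2 hm
    refine (H hmI (lt_of_le_of_lt ?_ hst)).le
    rw [Real.dist_eq]
    rw [abs_sub_comm, abs_sub_comm s]
    exact Set.abs_sub_right_of_mem_uIcc hm

end TimeScale

/-! ### Existence of the matrix exponential and of trajectories. -/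

namespace TimeScale

section Volterra

variable {E : Type*} [NormedAddCommGroup E] [NormedSpace ℝ E]

/-- The Picard iterates of the equation `y t = y₀ t + ∫ L (y (φ s))`. -/
noncomputable def volterraTerm (L : E →L[ℝ] E) (φ : ℝ → ℝ) (a : ℝ) (y₀ : ℝ → E) : ℕ → ℝ → E
  | 0 => y₀
  | k + 1 => fun t => ∫ s in a..t, L (volterraTerm L φ a y₀ k (φ s))

variable {L : E →L[ℝ] E} {φ : ℝ → ℝ} {a : ℝ} {y₀ : ℝ → E}

theorem continuous_volterraTerm (hφ : Monotone φ) (hy : Continuous y₀) (k : ℕ) :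
    Continuous (volterraTerm L φ a y₀ k) := by
  induction k with
  | zero => exact hy
  | succ k ih =>
    exact intervalIntegral.continuous_primitive
      (fun a b => intervalIntegrable_comp_monotone (L.continuous.comp ih) hφ a b) a

/-- The usual factorial bound for Picard iterates survives the delay because `a ≤ φ s ≤ s` and the
bound increases with time. -/
theorem norm_volterraTerm_le (hφa : ∀ s, a ≤ φ s) (hφs : ∀ s, a ≤ s → φ s ≤ s) {M b : ℝ}
    (hM : ∀ t ∈ Set.Icc a b, ‖y₀ t‖ ≤ M) (k : ℕ) :
    ∀ t ∈ Set.Icc a b, ‖volterraTerm L φ a y₀ k t‖ ≤ M * ((‖L‖ * (t - a)) ^ k / k.factorial) := by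
  induction k with
  | zero => simpa [volterraTerm] using hM
  | succ k ih =>
    intro t ht
    have hM0 : 0 ≤ M := (norm_nonneg _).trans (hM t ht)
    have hcont : Continuous fun s : ℝ => ‖L‖ * (M * ((‖L‖ * (s - a)) ^ k / k.factorial)) := by
      fun_prop
    calc ‖volterraTerm L φ a y₀ (k + 1) t‖
        ≤ ∫ s in a..t, ‖L‖ * (M * ((‖L‖ * (s - a)) ^ k / k.factorial)) := by
          refine intervalIntegral.norm_integral_le_of_norm_le ht.1
            (Eventually.of_forall fun s hs => ?_) (hcont.intervalIntegrable _ _)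
          refine (L.le_opNorm _).trans (mul_le_mul_of_nonneg_left ?_ (norm_nonneg _))
          have h1 := hφs s hs.1.le
          have h2 := hφa s
          refine (ih (φ s) ⟨h2, h1.trans (hs.2.trans ht.2)⟩).trans ?_
          have h3 : 0 ≤ φ s - a := sub_nonneg.2 h2
          gcongr
      _ = M * ((‖L‖ * (t - a)) ^ (k + 1) / (k + 1).factorial) := by
          have h1 : ∀ s : ℝ, ‖L‖ * (M * ((‖L‖ * (s - a)) ^ k / k.factorial)) =
              (M * ‖L‖ ^ (k + 1) / k.factorial) * (s - a) ^ k := fun s => by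
            rw [mul_pow]
            ring
          simp only [h1]
          rw [intervalIntegral.integral_const_mul,
            intervalIntegral.integral_comp_sub_right (fun s => s ^ k), integral_pow,
            Nat.factorial_succ, mul_pow]
          push_cast
          have : (k.factorial : ℝ) ≠ 0 := by positivity
          field_simp
          simp

open MeasureTheory in
/-- Linear Volterra equations with a nonanticipating monotone delay have a continuous solution. -/
theorem exists_volterra_solution [CompleteSpace E] (L : E →L[ℝ] E) (hφ : Monotone φ)
    (hφa : ∀ s, a ≤ φ s) (hφs : ∀ s, a ≤ s → φ s ≤ s) (hy : Continuous y₀) :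
    ∃ y : ℝ → E, Continuous y ∧ ∀ t, a ≤ t → y t = y₀ t + ∫ s in a..t, L (y (φ s)) := by
  set Y := volterraTerm L φ a y₀ with hY
  have hYc : ∀ k, Continuous (Y k) := continuous_volterraTerm hφ hy
  have hbd : ∀ b, ∃ u : ℕ → ℝ, Summable u ∧ ∀ k, ∀ t ∈ Set.Icc a b, ‖Y k t‖ ≤ u k := by
    intro b
    obtain ⟨M, hM⟩ := (isCompact_Icc (a := a) (b := b)).exists_bound_of_continuousOn hy.continuousOn
    refine ⟨fun k => M * ((‖L‖ * (b - a)) ^ k / k.factorial),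
      (Real.summable_pow_div_factorial _).mul_left M, fun k t ht => ?_⟩
    refine (norm_volterraTerm_le hφa hφs hM k t ht).trans ?_
    have hM0 : 0 ≤ M := (norm_nonneg _).trans (hM t ht)
    have h1 := sub_nonneg.2 ht.1
    have h2 : t - a ≤ b - a := sub_le_sub_right ht.2 a
    have h3 := norm_nonneg L
    show M * ((‖L‖ * (t - a)) ^ k / k.factorial) ≤ M * ((‖L‖ * (b - a)) ^ k / k.factorial)
    gcongr
  have hsum : ∀ t, a ≤ t → Summable fun k => Y k t := by
    intro t ht
    obtain ⟨u, hu, hb⟩ := hbd t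
    exact Summable.of_norm_bounded hu fun k => hb k t ⟨ht, le_rfl⟩
  -- The series is controlled only to the right of `a`; freezing the argument at `a` gives a
  -- function continuous on the whole line.
  refine ⟨fun t => ∑' k, Y k (max a t), ?_, fun t ht => ?_⟩
  · rw [continuous_iff_continuousAt]
    intro t
    obtain ⟨u, hu, hb⟩ := hbd (max a t + 1)
    have : ContinuousOn (fun t => ∑' k, Y k (max a t)) (Set.Iio (t + 1)) := by
      refine continuousOn_tsum (fun k => ((hYc k).comp (by fun_prop)).continuousOn) hu
        fun k s hs => hb k _ ⟨le_max_left _ _, max_le ?_ ?_⟩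
      · linarith [le_max_left a t]
      · have : s < t + 1 := hs
        linarith [le_max_right a t]
    exact this.continuousAt (Iio_mem_nhds (by linarith))
  · have hstep : HasSum (fun k => ∫ s in a..t, L (Y k (φ s)))
        (∫ s in a..t, L (∑' k, Y k (max a (φ s)))) := by
      obtain ⟨u, hu, hb⟩ := hbd t
      refine intervalIntegral.hasSum_integral_of_dominated_convergence (fun k _ => ‖L‖ * u k)
        (fun k => ?_) (fun k => Eventually.of_forall fun s hs => ?_)
        (Eventually.of_forall fun s _ => hu.mul_left _) intervalIntegrable_const
        (Eventually.of_forall fun s hs => ?_)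
      · exact ((L.continuous.comp (hYc k)).comp_stronglyMeasurable
          hφ.measurable.stronglyMeasurable).aestronglyMeasurable
      · rw [Set.uIoc_of_le ht] at hs
        refine (L.le_opNorm _).trans (mul_le_mul_of_nonneg_left ?_ (norm_nonneg _))
        exact hb k _ ⟨hφa s, (hφs s hs.1.le).trans hs.2⟩
      · simp only [max_eq_right (hφa s)]
        exact (hsum _ (hφa s)).hasSum.mapL L
    beta_reduce
    rw [max_eq_right ht, (hsum t ht).tsum_eq_zero_add, ← hstep.tsum_eq]
    rfl

end Volterra

variable {T : Set ℝ} {n m : ℕ} {a t₀ t₁ : ℝ}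

theorem intervalIntegral_apply {q : ℝ → Fin n → ℝ} {a b : ℝ}
    (hq : IntervalIntegrable q MeasureTheory.volume a b) (i : Fin n) :
    (∫ s in a..b, q s) i = ∫ s in a..b, q s i :=
  ((ContinuousLinearMap.proj (R := ℝ) (φ := fun _ : Fin n => ℝ) i).intervalIntegral_comp_comm
    hq).symm

/-- The equation `x^Δ = A x + f` in integrated form, with initial value `v`. -/
theorem exists_integral_solution (hT : IsClosed T) (ha : a ∈ T) (A : Matrix (Fin n) (Fin n) ℝ)
    (v : Fin n → ℝ) {f : ℝ → Fin n → ℝ}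
    (hf : ∀ a' b', IntervalIntegrable (fun s => f (floorPt T a s)) MeasureTheory.volume a' b') :
    ∃ x : ℝ → Fin n → ℝ, Continuous x ∧
      (∀ a' b' i, IntervalIntegrable (fun s => (A *ᵥ x (floorPt T a s) + f (floorPt T a s)) i)
        MeasureTheory.volume a' b') ∧
      ∀ t, a ≤ t → ∀ i,
        x t i = v i + ∫ s in a..t, (A *ᵥ x (floorPt T a s) + f (floorPt T a s)) i := by
  obtain ⟨x, hxc, hx⟩ := exists_volterra_solution (a := a) (φ := floorPt T a)
    (y₀ := fun t => v + ∫ s in a..t, f (floorPt T a s)) (A.mulVecLin.toContinuousLinearMap)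
    (floorPt_mono ha) (fun s => (floorPt_mem_inter hT ha s).2.1) (fun s => floorPt_le hT ha)
    (continuous_const.add (intervalIntegral.continuous_primitive hf a))
  have hAx : ∀ a' b', IntervalIntegrable (fun s => A *ᵥ x (floorPt T a s))
      MeasureTheory.volume a' b' :=
    intervalIntegrable_comp_monotone (y := fun s => A *ᵥ x s) (by fun_prop) (floorPt_mono ha)
  have happ : ∀ (q : ℝ → Fin n → ℝ) a' b' i, IntervalIntegrable q MeasureTheory.volume a' b' →
      IntervalIntegrable (fun s => q s i) MeasureTheory.volume a' b' := fun q a' b' i hq => by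
    exact ⟨(ContinuousLinearMap.proj (R := ℝ) (φ := fun _ : Fin n => ℝ) i).integrable_comp hq.1,
      (ContinuousLinearMap.proj (R := ℝ) (φ := fun _ : Fin n => ℝ) i).integrable_comp hq.2⟩
  refine ⟨x, hxc, fun a' b' i => happ _ a' b' i ((hAx a' b').add (hf a' b')), fun t ht i => ?_⟩
  have h1 : x t = v + ∫ s in a..t, (A *ᵥ x (floorPt T a s) + f (floorPt T a s)) := by
    rw [hx t ht, intervalIntegral.integral_add (hAx a t) (hf a t)]
    simp only [LinearMap.coe_toContinuousLinearMap', Matrix.mulVecLin_apply]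
    abel
  conv_lhs => rw [h1]
  rw [Pi.add_apply, intervalIntegral_apply ((hAx a t).add (hf a t))]

/-- Column `j` is the homogeneous solution that starts at the `j`-th unit vector. This is what makes
the choice in `matrixExp` meaningful. -/
theorem exists_isMatrixExp (hT : IsClosed T) (ha : a ∈ T) (A : Matrix (Fin n) (Fin n) ℝ) :
    ∃ X, IsMatrixExp T A a X := by
  choose y hyc hyi hy using fun j : Fin n => exists_integral_solution (f := fun _ => 0) hT ha A
    (Pi.single j 1) (fun a' b' => intervalIntegrable_const)
  refine ⟨fun t => Matrix.of fun i j => y j t i, ?_, fun t ht i j => ?_⟩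
  · ext i j
    simp [hy j a le_rfl i, Pi.single_apply, Matrix.one_apply]
  · have := hasDeltaDerivAt_of_integral_floorPt (h := fun s => (A *ᵥ y j s + 0) i)
      (F := fun s => y j s i) (C := (Pi.single j 1 : Fin n → ℝ) i) hT ha isClosed_Ici
      Set.ordConnected_Ici subset_rfl ht.1 (fun a' b' => hyi j a' b' i)
      (fun s hs => hy j s hs.2 i) (Continuous.continuousWithinAt (by fun_prop))
    simp only [add_zero] at this
    exact this

theorem isMatrixExp_matrixExp (hT : IsClosed T) (ha : a ∈ T) (A : Matrix (Fin n) (Fin n) ℝ) :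
    IsMatrixExp T A a (fun t => matrixExp T A t a) :=
  Classical.epsilon_spec (exists_isMatrixExp hT ha A)

/-- Controls are constrained only on `[c, t₁)` while derivatives are taken on `[c, t₁]`; the point
`t₁` is invisible near `t < t₁`. -/
theorem mem_nhdsWithin_Icc_Ico {S : Set ℝ} {t c t₁ : ℝ} (h : t < t₁) :
    S ∩ Set.Ico c t₁ ∈ 𝓝[S ∩ Set.Icc c t₁] t := by
  filter_upwards [self_mem_nhdsWithin, mem_nhdsWithin_of_mem_nhds (Iio_mem_nhds h)] with s h1 h2
  exact ⟨h1.1, h1.2.1, h2⟩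

/-- Bounded measurable right-continuous controls have trajectories. -/
theorem exists_isTrajectory (hT : IsClosed T) (ht₀ : t₀ ∈ T)
    (A : Matrix (Fin n) (Fin n) ℝ) (B : Matrix (Fin n) (Fin m) ℝ) {u : ℝ → Fin m → ℝ}
    (hum : Measurable u) {C : ℝ} (huC : ∀ s, ‖u s‖ ≤ C)
    (hur : ∀ t ∈ T ∩ Set.Ico t₀ t₁, ContinuousWithinAt u (T ∩ Set.Ico t t₁) t) :
    ∃ x, IsTrajectory T A B t₀ t₁ u x ∧ x t₀ = 0 := by
  obtain ⟨x, hxc, hxi, hx⟩ := exists_integral_solution (f := fun s => B *ᵥ u s) hT ht₀ A 0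
    (fun a' b' => by
      set LB := B.mulVecLin.toContinuousLinearMap
      refine intervalIntegrable_of_norm_le (C := ‖LB‖ * C) ?_ fun s _ => ?_
      · exact LB.continuous.comp_stronglyMeasurable
          (hum.comp (floorPt_mono ht₀).measurable).stronglyMeasurable
      · exact (LB.le_opNorm _).trans (mul_le_mul_of_nonneg_left (huC _) (norm_nonneg _)))
  have hcont : ∀ (S : Set ℝ) t, ContinuousWithinAt u S t → ∀ i,
      ContinuousWithinAt (fun s => (A *ᵥ x s + B *ᵥ u s) i) S t := by
    intro S t hu i
    have h1 : ContinuousWithinAt (fun s => (A *ᵥ x s) i) S t :=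
      Continuous.continuousWithinAt (by fun_prop)
    have h2 : ContinuousWithinAt (fun s => (B *ᵥ u s) i) S t :=
      (by fun_prop : Continuous fun w : Fin m → ℝ => (B *ᵥ w) i).continuousAt.comp_continuousWithinAt
        hu
    exact h1.add h2
  refine ⟨x, ⟨hxc.continuousOn, fun t ht => ⟨fun i => ?_, fun hu i => ?_⟩⟩, ?_⟩
  · exact hasDeltaDerivAt_of_integral_floorPt (h := fun s => (A *ᵥ x s + B *ᵥ u s) i) hT ht₀
      isClosed_Icc Set.ordConnected_Icc (fun s hs => ht.2.1.trans hs.1)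
      ⟨ht.1, le_rfl, ht.2.2.le⟩ (fun a' b' => hxi a' b' i)
      (fun s hs => hx s (ht.2.1.trans hs.2.1) i)
      ((hcont _ t (hur t ht) i).mono_of_mem_nhdsWithin (mem_nhdsWithin_Icc_Ico ht.2.2))
  · exact hasDeltaDerivAt_of_integral_floorPt (h := fun s => (A *ᵥ x s + B *ᵥ u s) i) hT ht₀
      isClosed_Icc Set.ordConnected_Icc (fun s hs => hs.1)
      ⟨ht.1, ht.2.1, ht.2.2.le⟩ (fun a' b' => hxi a' b' i)
      (fun s hs => hx s hs.2.1 i)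
      ((hcont _ t hu i).mono_of_mem_nhdsWithin (mem_nhdsWithin_Icc_Ico ht.2.2))
  · ext i
    simp [hx t₀ le_rfl i]

end TimeScale

/-! ### Growth, uniqueness and continuity of the matrix exponential. -/

namespace TimeScale

variable {T : Set ℝ} {n : ℕ} {a b s t r : ℝ} {A : Matrix (Fin n) (Fin n) ℝ}

theorem exists_abs_mulVec_le (A : Matrix (Fin n) (Fin n) ℝ) :
    ∃ K, 0 < K ∧ ∀ v i, |(A *ᵥ v) i| ≤ K * ‖v‖ := by
  refine ⟨‖A.mulVecLin.toContinuousLinearMap‖ + 1, by positivity, fun v i => ?_⟩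
  have h1 := (norm_le_pi_norm (A *ᵥ v) i).trans (A.mulVecLin.toContinuousLinearMap.le_opNorm v)
  rw [Real.norm_eq_abs] at h1
  nlinarith [norm_nonneg v]

/-- By convexity, every forward difference quotient of the exponential is at least its derivative on
the left. It can therefore serve as the comparison function `g` on any time scale, across gaps too.
-/
theorem exp_sub_le (L t s a c : ℝ) (hc : 0 ≤ c) :
    L * c * Real.exp (L * (t - a)) * (s - t) ≤
      c * Real.exp (L * (s - a)) - c * Real.exp (L * (t - a)) := by
  have h1 := Real.add_one_le_exp (L * (s - t))
  have h2 : Real.exp (L * (s - a)) = Real.exp (L * (t - a)) * Real.exp (L * (s - t)) := by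
    rw [← Real.exp_add]
    ring_nf
  rw [h2]
  nlinarith [mul_le_mul_of_nonneg_left h1 (mul_nonneg hc (Real.exp_pos (L * (t - a))).le)]

/-- Componentwise growth bound from a bound on the forward delta derivative. -/
theorem abs_sub_le_of_hasForwardDerivAt (hT : IsClosed T) (ha : a ∈ T) (hb : b ∈ T) (hab : a ≤ b)
    {f g D : ℝ → ℝ} (hf : ContinuousOn f (T ∩ Set.Icc a b)) (hg : ContinuousOn g (T ∩ Set.Icc a b))
    (hfd : ∀ t ∈ T ∩ Set.Ico a b, ∃ d, |d| ≤ D t ∧ HasForwardDerivAt T f d t)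
    (hgd : ∀ t ∈ T ∩ Set.Ico a b, ∀ s ∈ T, t < s → D t * (s - t) ≤ g s - g t) :
    |f b - f a| ≤ g b - g a := by
  rw [abs_le]
  constructor
  · have := sub_le_sub_of_hasForwardDerivAt (f := fun t => - f t) hT ha hb hab hf.neg hg
      (fun t ht => (hfd t ht).elim fun d hd => ⟨-d, (neg_le_abs d).trans hd.1, hd.2.neg⟩) hgd
    linarith
  · exact sub_le_sub_of_hasForwardDerivAt hT ha hb hab hf hg
      (fun t ht => (hfd t ht).elim fun d hd => ⟨d, (le_abs_self d).trans hd.1, hd.2⟩) hgd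

/-- A Grönwall bound for forward solutions of `y^Δ = A y`. -/
theorem norm_le_of_forward_solution (hT : IsClosed T) (ha : a ∈ T) {K : ℝ} (hK : 0 < K)
    (hA : ∀ v i, |(A *ᵥ v) i| ≤ K * ‖v‖) {y : ℝ → Fin n → ℝ}
    (hy : ContinuousOn y (T ∩ Set.Icc a b))
    (hyd : ∀ t ∈ T ∩ Set.Ico a b, ∀ i, HasForwardDerivAt T (fun s => y s i) ((A *ᵥ y t) i) t)
    (ht : t ∈ T ∩ Set.Icc a b) : ‖y t‖ ≤ 2 * ‖y a‖ * Real.exp (2 * K * (t - a)) := by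
  have hcomp : IsCompact (T ∩ Set.Icc a b) := isCompact_Icc.inter_left hT
  -- At a maximum `c` of the weighted norm the rate `2 * K`, twice the bound on `A`, makes the
  -- growth from `a` to `c` at most `‖y c‖ / 2`. Hence `‖y c‖ ≤ 2 * ‖y a‖`.
  obtain ⟨c, hc, hmax⟩ := hcomp.exists_isMaxOn ⟨t, ht⟩
    (f := fun s => Real.exp (-(2 * K * (s - a))) * ‖y s‖)
    (ContinuousOn.mul (Continuous.continuousOn (by fun_prop)) hy.norm)
  set N := Real.exp (-(2 * K * (c - a))) * ‖y c‖ with hN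
  have hN0 : 0 ≤ N := by positivity
  have hle : ∀ s ∈ T ∩ Set.Icc a b, ‖y s‖ ≤ N * Real.exp (2 * K * (s - a)) := by
    intro s hs
    have h1 : Real.exp (-(2 * K * (s - a))) * ‖y s‖ ≤ N := hmax hs
    rwa [Real.exp_neg, inv_mul_le_iff₀ (Real.exp_pos _), mul_comm] at h1
  have hceq : ‖y c‖ = N * Real.exp (2 * K * (c - a)) := by
    rw [hN, Real.exp_neg]
    field_simp
  have hsub : T ∩ Set.Icc a c ⊆ T ∩ Set.Icc a b := fun s hs => ⟨hs.1, hs.2.1, hs.2.2.trans hc.2.2⟩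
  have hcomp : ∀ i, |y c i - y a i| ≤
      N / 2 * Real.exp (2 * K * (c - a)) - N / 2 * Real.exp (2 * K * (a - a)) := by
    intro i
    refine abs_sub_le_of_hasForwardDerivAt hT ha hc.1 hc.2.1
      (D := fun s => 2 * K * (N / 2) * Real.exp (2 * K * (s - a)))
      (f := fun s => y s i) (g := fun s => N / 2 * Real.exp (2 * K * (s - a)))
      ((continuousOn_pi.1 hy i).mono hsub)
      (Continuous.continuousOn (by fun_prop)) (fun s hs => ⟨_, ?_, hyd s
        ⟨hs.1, hs.2.1, hs.2.2.trans_le hc.2.2⟩ i⟩)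
      (fun s _ s' _ _ => exp_sub_le _ _ _ _ _ (by positivity))
    refine (hA _ _).trans ?_
    have := hle s (hsub ⟨hs.1, hs.2.1, hs.2.2.le⟩)
    nlinarith
  have hye : 1 ≤ Real.exp (2 * K * (c - a)) :=
    Real.one_le_exp (mul_nonneg (by positivity) (sub_nonneg.2 hc.2.1))
  have hb : ‖y c‖ ≤ ‖y a‖ + N / 2 * Real.exp (2 * K * (c - a)) := by
    refine (pi_norm_le_iff_of_nonneg (by positivity)).2 fun i => ?_
    have h1 := hcomp i
    have h2 := norm_le_pi_norm (y a) i
    have h3 := abs_sub_abs_le_abs_sub (y c i) (y a i)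
    have h4 : 0 ≤ N / 2 * Real.exp (2 * K * (a - a)) := by positivity
    rw [Real.norm_eq_abs] at h2 ⊢
    linarith
  have hN2 : N ≤ 2 * ‖y a‖ := by
    rw [hceq] at hb
    nlinarith
  exact (hle t ht).trans (mul_le_mul_of_nonneg_right hN2 (Real.exp_pos _).le)

theorem matrixExp_self (hT : IsClosed T) (ha : a ∈ T) (A : Matrix (Fin n) (Fin n) ℝ) :
    matrixExp T A a a = 1 :=
  (isMatrixExp_matrixExp hT ha A).1

/-- Where no derivative is available, the point is a maximum of `S` that is not left-dense, hence
isolated in `S`. -/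
theorem continuousOn_of_hasDeltaDerivAt_kappa {S : Set ℝ} {f d : ℝ → ℝ}
    (h : ∀ t ∈ kappa S, HasDeltaDerivAt S f (d t) t) : ContinuousOn f S := by
  intro t ht
  by_cases htk : t ∈ kappa S
  · exact (h t htk).continuousWithinAt ht
  have h1 : ∀ s ∈ S, s ≤ t := fun s hs => by
    by_contra! hc
    exact htk ⟨ht, Or.inl ⟨s, hs, hc⟩⟩
  have h2 : ¬ LeftDense S t := fun hc => htk ⟨ht, Or.inr hc⟩
  have hiso : ∃ c < t, ∀ s ∈ S, c < s → s = t := by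
    by_cases hex : ∃ s ∈ S, s < t
    · have hne : backwardJump S t ≠ t := fun hc => h2 ⟨hex, hc⟩
      have hbdd : BddAbove {s | s ∈ S ∧ s < t} := ⟨t, fun s hs => hs.2.le⟩
      have hle : backwardJump S t ≤ t := by
        rw [backwardJump, if_pos hex]
        exact csSup_le hex fun s hs => hs.2.le
      refine ⟨backwardJump S t, lt_of_le_of_ne hle hne, fun s hs hcs => ?_⟩
      refine le_antisymm (h1 s hs) (not_lt.1 fun hst => hcs.not_ge ?_)
      rw [backwardJump, if_pos hex]
      exact le_csSup hbdd ⟨hs, hst⟩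
    · refine ⟨t - 1, by linarith, fun s hs _ => le_antisymm (h1 s hs) (not_lt.1 fun hst => ?_)⟩
      exact hex ⟨s, hs, hst⟩
  obtain ⟨c, hct, hc⟩ := hiso
  refine (continuousWithinAt_singleton (f := f) (x := t)).mono_of_mem_nhdsWithin ?_
  filter_upwards [self_mem_nhdsWithin, mem_nhdsWithin_of_mem_nhds (Ioi_mem_nhds hct)] with s hs hcs
  exact hc s hs hcs

theorem continuousOn_matrixExp (hT : IsClosed T) (ha : a ∈ T) (A : Matrix (Fin n) (Fin n) ℝ)
    (i j : Fin n) : ContinuousOn (fun t => matrixExp T A t a i j) (T ∩ Set.Ici a) :=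
  continuousOn_of_hasDeltaDerivAt_kappa fun t ht => (isMatrixExp_matrixExp hT ha A).2 t ht i j

theorem continuousOn_matrixExp_mulVec (hT : IsClosed T) (ha : a ∈ T)
    (A : Matrix (Fin n) (Fin n) ℝ) (v : Fin n → ℝ) :
    ContinuousOn (fun t => matrixExp T A t a *ᵥ v) (T ∩ Set.Ici a) := by
  refine continuousOn_pi.2 fun i => ?_
  simp only [Matrix.mulVec, dotProduct]
  exact continuousOn_finsetSum _ fun j _ => (continuousOn_matrixExp hT ha A i j).mul_const _

theorem mem_kappa_Ici (ht : t ∈ T) (hat : a ≤ t) (hb : b ∈ T) (htb : t < b) :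
    t ∈ kappa (T ∩ Set.Ici a) :=
  ⟨⟨ht, hat⟩, Or.inl ⟨b, ⟨hb, hat.trans htb.le⟩, htb⟩⟩

theorem hasForwardDerivAt_matrixExp (hT : IsClosed T) (ha : a ∈ T) (A : Matrix (Fin n) (Fin n) ℝ)
    (ht : t ∈ T) (hat : a ≤ t) (hb : b ∈ T) (htb : t < b) (i j : Fin n) :
    HasForwardDerivAt T (fun s => matrixExp T A s a i j) ((A * matrixExp T A t a) i j) t :=
  ((isMatrixExp_matrixExp hT ha A).2 t (mem_kappa_Ici ht hat hb htb) i j).hasForwardDerivAt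
    ⟨ht, hat⟩ hb htb fun _ hs _ => ⟨fun h => h.1, fun h => ⟨h, hat.trans hs.le⟩⟩

theorem hasForwardDerivAt_matrixExp_mulVec (hT : IsClosed T) (ha : a ∈ T)
    (A : Matrix (Fin n) (Fin n) ℝ) (ht : t ∈ T) (hat : a ≤ t) (hb : b ∈ T) (htb : t < b)
    (v : Fin n → ℝ) (i : Fin n) :
    HasForwardDerivAt T (fun s => (matrixExp T A s a *ᵥ v) i)
      ((A *ᵥ (matrixExp T A t a *ᵥ v)) i) t := by
  have := HasForwardDerivAt.sum (I := Finset.univ) fun j _ =>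
    (hasForwardDerivAt_matrixExp hT ha A ht hat hb htb i j).const_mul (v j)
  rw [Matrix.mulVec_mulVec]
  simpa only [Matrix.mulVec, dotProduct, mul_comm (v _)] using this

/-- Forward solutions of `y^Δ = A y` are given by the matrix exponential. -/
theorem eq_matrixExp_mulVec (hT : IsClosed T) (ha : a ∈ T) (hb : b ∈ T) (hab : a ≤ b)
    {y : ℝ → Fin n → ℝ} (hy : ContinuousOn y (T ∩ Set.Icc a b))
    (hyd : ∀ t ∈ T ∩ Set.Ico a b, ∀ i, HasForwardDerivAt T (fun s => y s i) ((A *ᵥ y t) i) t) :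
    y b = matrixExp T A b a *ᵥ y a := by
  obtain ⟨K, hK, hA⟩ := exists_abs_mulVec_le A
  -- The difference of two solutions with the same initial value starts at zero, so the growth bound
  -- annihilates it.
  have h := norm_le_of_forward_solution (y := fun t => y t - matrixExp T A t a *ᵥ y a)
    hT ha hK hA (hy.sub ((continuousOn_matrixExp_mulVec hT ha A (y a)).mono
      fun s hs => ⟨hs.1, hs.2.1⟩))
    (fun t ht i => by
      rw [Matrix.mulVec_sub]
      exact (hyd t ht i).sub
        (hasForwardDerivAt_matrixExp_mulVec hT ha A ht.1 ht.2.1 hb ht.2.2 (y a) i))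
    (⟨hb, hab, le_rfl⟩ : b ∈ T ∩ Set.Icc a b)
  rw [matrixExp_self hT ha, Matrix.one_mulVec, sub_self, norm_zero, mul_zero, zero_mul] at h
  exact sub_eq_zero.1 (norm_le_zero_iff.1 h)

theorem matrixExp_mulVec_matrixExp_mulVec (hT : IsClosed T) (hs : s ∈ T) (hr : r ∈ T) (hb : b ∈ T)
    (hsr : s ≤ r) (hrb : r ≤ b) (A : Matrix (Fin n) (Fin n) ℝ) (v : Fin n → ℝ) :
    matrixExp T A b s *ᵥ v = matrixExp T A b r *ᵥ (matrixExp T A r s *ᵥ v) :=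
  eq_matrixExp_mulVec (y := fun t => matrixExp T A t s *ᵥ v) hT hr hb hrb
    ((continuousOn_matrixExp_mulVec hT hs A v).mono fun _ ht => ⟨ht.1, hsr.trans ht.2.1⟩)
    fun _ ht i => hasForwardDerivAt_matrixExp_mulVec hT hs A ht.1 (hsr.trans ht.2.1) hb ht.2.2 v i

theorem norm_matrixExp_mulVec_le (hT : IsClosed T) (hs : s ∈ T) (ht : t ∈ T) (hst : s ≤ t)
    {K : ℝ} (hK : 0 < K) (hA : ∀ v i, |(A *ᵥ v) i| ≤ K * ‖v‖) (v : Fin n → ℝ) :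
    ‖matrixExp T A t s *ᵥ v‖ ≤ 2 * ‖v‖ * Real.exp (2 * K * (t - s)) := by
  have h := norm_le_of_forward_solution (y := fun r => matrixExp T A r s *ᵥ v) (b := t) hT hs hK hA
    ((continuousOn_matrixExp_mulVec hT hs A v).mono fun _ hr => ⟨hr.1, hr.2.1⟩)
    (fun r hr i => hasForwardDerivAt_matrixExp_mulVec hT hs A hr.1 hr.2.1 ht hr.2.2 v i)
    (⟨ht, hst, le_rfl⟩ : t ∈ T ∩ Set.Icc s t)
  rwa [matrixExp_self hT hs, Matrix.one_mulVec] at h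

/-- The growth bound also bounds the derivative, so the displacement is linear in `t - s`. This
yields the Lipschitz estimate in the initial time. -/
theorem norm_matrixExp_mulVec_sub_le (hT : IsClosed T) (hs : s ∈ T) (ht : t ∈ T) (hst : s ≤ t)
    {K : ℝ} (hK : 0 < K) (hA : ∀ v i, |(A *ᵥ v) i| ≤ K * ‖v‖) (v : Fin n → ℝ) :
    ‖matrixExp T A t s *ᵥ v - v‖ ≤ K * (2 * ‖v‖ * Real.exp (2 * K * (t - s))) * (t - s) := by
  have h0 := sub_nonneg.2 hst
  refine (pi_norm_le_iff_of_nonneg (by positivity)).2 fun i => ?_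
  set C := K * (2 * ‖v‖ * Real.exp (2 * K * (t - s))) with hC
  have := abs_sub_le_of_hasForwardDerivAt (f := fun r => (matrixExp T A r s *ᵥ v) i)
    (g := fun r => C * r) (D := fun _ => C) hT hs ht hst
    ((continuousOn_pi.1 (continuousOn_matrixExp_mulVec hT hs A v) i).mono
      fun _ hr => ⟨hr.1, hr.2.1⟩) (Continuous.continuousOn (by fun_prop))
    (fun r hr => ⟨_, ?_, hasForwardDerivAt_matrixExp_mulVec hT hs A hr.1 hr.2.1 ht hr.2.2 v i⟩)
    (fun r _ r' _ _ => by linarith)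
  · rw [matrixExp_self hT hs, Matrix.one_mulVec] at this
    rw [Real.norm_eq_abs, Pi.sub_apply]
    linarith
  · refine (hA _ _).trans (mul_le_mul_of_nonneg_left ?_ hK.le)
    refine (norm_matrixExp_mulVec_le hT hs hr.1 hr.2.1 hK hA v).trans ?_
    have := hr.2.2.le
    gcongr

/-- The matrix exponential is continuous in its initial time. -/
theorem continuousOn_matrixExp_left (hT : IsClosed T) (hb : b ∈ T)
    (A : Matrix (Fin n) (Fin n) ℝ) (i j : Fin n) :
    ContinuousOn (fun s => matrixExp T A b s i j) (T ∩ Set.Icc a b) := by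
  obtain ⟨K, hK, hA⟩ := exists_abs_mulVec_le A
  set v : Fin n → ℝ := Pi.single j 1 with hv
  set e := Real.exp (2 * K * (b - a)) with he
  have he0 : 0 < e := Real.exp_pos _
  set C := 2 * (K * (2 * ‖v‖ * e)) * e with hC
  have hC0 : 0 ≤ C := by positivity
  have hentry : ∀ s, matrixExp T A b s i j = (matrixExp T A b s *ᵥ v) i := fun s => by simp [hv]
  have key : ∀ s ∈ T ∩ Set.Icc a b, ∀ r ∈ T ∩ Set.Icc a b, s ≤ r →
      |matrixExp T A b r i j - matrixExp T A b s i j| ≤ C * (r - s) := by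
    intro s hs r hr hsr
    -- The semigroup identity replaces differentiation in the initial time: changing `s` to `r`
    -- amounts to propagating the small vector `e_A(r, s) v - v` from `r` to `b`.
    have h1 : matrixExp T A b s i j - matrixExp T A b r i j =
        (matrixExp T A b r *ᵥ (matrixExp T A r s *ᵥ v - v)) i := by
      rw [Matrix.mulVec_sub, ← matrixExp_mulVec_matrixExp_mulVec hT hs.1 hr.1 hb hsr hr.2.2,
        Pi.sub_apply, hentry, hentry]
    rw [abs_sub_comm, h1]
    have h0 := sub_nonneg.2 hsr
    have has := hs.2.1
    have hrb := hr.2.2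
    have har := hr.2.1
    calc |(matrixExp T A b r *ᵥ (matrixExp T A r s *ᵥ v - v)) i|
        ≤ ‖matrixExp T A b r *ᵥ (matrixExp T A r s *ᵥ v - v)‖ := by
          rw [← Real.norm_eq_abs]
          exact norm_le_pi_norm _ i
      _ ≤ 2 * ‖matrixExp T A r s *ᵥ v - v‖ * Real.exp (2 * K * (b - r)) :=
          norm_matrixExp_mulVec_le hT hr.1 hb hrb hK hA _
      _ ≤ 2 * (K * (2 * ‖v‖ * Real.exp (2 * K * (r - s))) * (r - s)) *
            Real.exp (2 * K * (b - r)) := by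
          gcongr
          exact norm_matrixExp_mulVec_sub_le hT hs.1 hr.1 hsr hK hA v
      _ ≤ 2 * (K * (2 * ‖v‖ * e) * (r - s)) * e := by
          have h2 : Real.exp (2 * K * (r - s)) ≤ e := Real.exp_le_exp.2 (by gcongr)
          have h3 : Real.exp (2 * K * (b - r)) ≤ e := Real.exp_le_exp.2 (by gcongr)
          gcongr
      _ = C * (r - s) := by rw [hC]; ring
  have : LipschitzOnWith C.toNNReal (fun s => matrixExp T A b s i j) (T ∩ Set.Icc a b) := by
    refine LipschitzOnWith.of_dist_le_mul fun s hs r hr => ?_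
    rw [Real.coe_toNNReal _ hC0, Real.dist_eq, Real.dist_eq]
    rcases le_total s r with h | h
    · rw [abs_sub_comm, abs_sub_comm s, abs_of_nonneg (sub_nonneg.2 h)]
      exact key s hs r hr h
    · rw [abs_of_nonneg (sub_nonneg.2 h)]
      exact key r hr s hs h
  exact this.continuousOn

end TimeScale

/-! ### Variation of constants, consequences of positivity and step controls. -/

namespace TimeScale

variable {T : Set ℝ} {n m : ℕ} {t₀ t₁ s t : ℝ} {A : Matrix (Fin n) (Fin n) ℝ}
  {B : Matrix (Fin n) (Fin m) ℝ}

theorem IsTrajectory.hasForwardDerivAt {u : ℝ → Fin m → ℝ} {x : ℝ → Fin n → ℝ}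
    (h : IsTrajectory T A B t₀ t₁ u x) (ht₁ : t₁ ∈ T) (ht : t ∈ T ∩ Set.Ico t₀ t₁) (i : Fin n) :
    HasForwardDerivAt T (fun s => x s i) ((A *ᵥ x t + B *ᵥ u t) i) t :=
  ((h.2 t ht).1 i).hasForwardDerivAt ⟨ht.1, le_rfl, ht.2.2.le⟩ ht₁ ht.2.2
    fun _ hs hs' => ⟨fun h => h.1, fun h => ⟨h, hs.le, hs'⟩⟩

theorem continuousOn_matrixExp_mulVec_trajectory (hT : IsClosed T) (ht₁ : t₁ ∈ T)
    {x : ℝ → Fin n → ℝ} (hx : ContinuousOn x (T ∩ Set.Icc t₀ t₁)) (i : Fin n) :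
    ContinuousOn (fun s => (matrixExp T A t₁ s *ᵥ x s) i) (T ∩ Set.Icc t₀ t₁) := by
  simp only [Matrix.mulVec, dotProduct]
  exact continuousOn_finsetSum _ fun j _ =>
    (continuousOn_matrixExp_left hT ht₁ A i j).mul (continuousOn_pi.1 hx j)

/-- Variation of constants: the derivative of `e_A(t₁, s) x(s)` along a trajectory. -/
theorem IsTrajectory.hasForwardDerivAt_matrixExp_mulVec {u : ℝ → Fin m → ℝ} {x : ℝ → Fin n → ℝ}
    (h : IsTrajectory T A B t₀ t₁ u x) (hT : IsClosed T) (ht₁ : t₁ ∈ T)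
    (hs : s ∈ T ∩ Set.Ico t₀ t₁) (i : Fin n) :
    HasForwardDerivAt T (fun r => (matrixExp T A t₁ r *ᵥ x r) i)
      ((matrixExp T A t₁ (forwardJump T s) *ᵥ (B *ᵥ u s)) i) s := by
  obtain ⟨hsT, h0s, hs1⟩ := hs
  -- Comparison with the free motion from `x s`: the increment of `e_A(t₁, r) x(r)` from `s` equals
  -- `e_A(t₁, r)` applied to the deviation from this motion. The deviation vanishes at `s` with
  -- derivative `B u(s)`, so only continuity of `e_A(t₁, ·)` is needed, and its limit just after `s`
  -- is the value at `σ(s)`.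
  have hv : ∀ l, HasForwardDerivAt T (fun r => x r l - (matrixExp T A r s *ᵥ x s) l)
      ((B *ᵥ u s) l) s := by
    intro l
    have := (h.hasForwardDerivAt ht₁ ⟨hsT, h0s, hs1⟩ l).sub
      (TimeScale.hasForwardDerivAt_matrixExp_mulVec hT hsT A hsT le_rfl ht₁ hs1 (x s) l)
    rwa [matrixExp_self hT hsT, Matrix.one_mulVec, Pi.add_apply, add_sub_cancel_left] at this
  have hg : HasForwardDerivAt T
      (fun r => ∑ l, matrixExp T A t₁ r i l * (x r l - (matrixExp T A r s *ᵥ x s) l))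
      (∑ l, matrixExp T A t₁ (forwardJump T s) i l * (B *ᵥ u s) l) s := by
    refine HasForwardDerivAt.sum fun l _ => (hv l).mul_of_eq_zero ?_ ?_
    · rw [matrixExp_self hT hsT, Matrix.one_mulVec, sub_self]
    · exact tendsto_nextFilter (S := T ∩ Set.Icc s t₁) (w := fun r => matrixExp T A t₁ r i l) hs1
        (fun r hr hr' hrT => ⟨hrT, hr.le, hr'⟩)
        (continuousOn_matrixExp_left hT ht₁ A i l s ⟨hsT, le_rfl, hs1.le⟩)
  refine Tendsto.congr' ?_ hg
  filter_upwards [eventually_nextFilter hT ht₁ hs1] with r hr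
  congr 1
  have h1 := congrFun (matrixExp_mulVec_matrixExp_mulVec hT hsT hr.1 ht₁ hr.2.1.le hr.2.2 A (x s)) i
  rw [h1, matrixExp_self hT hsT, Matrix.one_mulVec]
  simp only [sub_self, mul_zero, Finset.sum_const_zero, sub_zero]
  rw [← Pi.sub_apply, ← Matrix.mulVec_sub]
  rfl

/-- Column `j` is the trajectory from the `j`-th unit vector under the zero control. -/
theorem matrixExp_nonneg (hT : IsClosed T) (hpos : IsPositiveSystem T A B) (hs : s ∈ T)
    (ht₁ : t₁ ∈ T) (hst : s ≤ t₁) (i j : Fin n) : 0 ≤ matrixExp T A t₁ s i j := by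
  have hcontrol : IsNonnegControl (m := m) T s t₁ fun _ => 0 := by
    refine ⟨⟨?_, fun t _ hc => (hc continuousWithinAt_const).elim⟩, fun t _ => le_rfl⟩
    convert Set.finite_empty (α := ℝ)
    ext t
    simp [continuousWithinAt_const]
  have htraj : IsTrajectory T A B s t₁ (fun _ => 0) fun t i => matrixExp T A t s i j := by
    refine ⟨continuousOn_pi.2 fun i => (continuousOn_matrixExp hT hs A i j).mono
      fun r hr => ⟨hr.1, hr.2.1⟩, fun t ht => ?_⟩
    have hd : ∀ i, HasDeltaDerivAt (T ∩ Set.Ici s) (fun r => matrixExp T A r s i j)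
        ((A *ᵥ (fun i => matrixExp T A t s i j) + B *ᵥ 0) i) t := fun i => by
      rw [Matrix.mulVec_zero, add_zero]
      exact (isMatrixExp_matrixExp hT hs A).2 t (mem_kappa_Ici ht.1 ht.2.1 ht₁ ht.2.2) i j
    have hj : forwardJump (T ∩ Set.Ici s) t = forwardJump T t := forwardJump_congr ht₁ ht.2.2
      fun r hr _ => ⟨fun h => h.1, fun h => ⟨h, ht.2.1.trans hr.le⟩⟩
    refine ⟨fun i => (hd i).mono (S := T ∩ Set.Icc t t₁)
        (fun r hr => ⟨hr.1, ht.2.1.trans hr.2.1⟩) ?_,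
      fun _ i => (hd i).mono (S := T ∩ Set.Icc s t₁) (fun r hr => ⟨hr.1, hr.2.1⟩) ?_⟩
    · exact (forwardJump_congr (S := T ∩ Set.Icc t t₁) ht₁ ht.2.2
        fun r hr hr' => ⟨fun h => h.1, fun h => ⟨h, hr.le, hr'⟩⟩).trans hj.symm
    · exact (forwardJump_congr (S := T ∩ Set.Icc s t₁) ht₁ ht.2.2
        fun r hr hr' => ⟨fun h => h.1, fun h => ⟨h, ht.2.1.trans hr.le, hr'⟩⟩).trans hj.symm
  refine hpos s hs t₁ ht₁ _ _ hcontrol htraj (fun i => ?_) t₁ ⟨ht₁, hst, le_rfl⟩ i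
  simp only [matrixExp_self hT hs, Matrix.one_apply, Pi.zero_apply]
  split_ifs <;> simp

section StepControl

variable {ι : Type*} [Fintype ι] {c d : ι → ℝ} {w : ι → Fin m → ℝ}

/-- The control that is the sum of the constants `w i` on the intervals `[c i, d i)`. -/
noncomputable def stepControl (c d : ι → ℝ) (w : ι → Fin m → ℝ) (s : ℝ) : Fin m → ℝ :=
  ∑ i, (Set.Ico (c i) (d i)).indicator (fun _ => w i) s

theorem indicator_Ico_right {E : Type*} [Zero E] (c d t : ℝ) (w : E) :
    (Set.Ico c d).indicator (fun _ => w) =ᶠ[𝓝[≥] t]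
      fun _ => (Set.Ico c d).indicator (fun _ => w) t := by
  have key : ∀ᶠ s in 𝓝[≥] t, (s ∈ Set.Ico c d ↔ t ∈ Set.Ico c d) := by
    rcases lt_or_ge t c with h | h
    · filter_upwards [mem_nhdsWithin_of_mem_nhds (Iio_mem_nhds h)] with s hs
      simp [not_le.2 h, not_le.2 (show s < c from hs)]
    rcases lt_or_ge t d with h' | h'
    · filter_upwards [mem_nhdsWithin_of_mem_nhds (Iio_mem_nhds h'), self_mem_nhdsWithin]
        with s hs hts
      simp [h, h', show s < d from hs, h.trans (show t ≤ s from hts)]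
    · filter_upwards [self_mem_nhdsWithin] with s hts
      simp [not_lt.2 h', not_lt.2 (h'.trans (show t ≤ s from hts))]
  filter_upwards [key] with s hs
  simp only [Set.indicator, hs]

theorem exists_indicator_Ico_left {E : Type*} [Zero E] (c d t : ℝ) (w : E) :
    ∃ l, (Set.Ico c d).indicator (fun _ => w) =ᶠ[𝓝[<] t] fun _ => l := by
  rcases le_or_gt t c with h | h
  · refine ⟨0, ?_⟩
    filter_upwards [self_mem_nhdsWithin] with s hs
    simp [(show s < t from hs).trans_le h]
  rcases le_or_gt t d with h' | h'
  · refine ⟨w, ?_⟩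
    filter_upwards [self_mem_nhdsWithin, mem_nhdsWithin_of_mem_nhds (Ioi_mem_nhds h)] with s hs hcs
    exact Set.indicator_of_mem (s := Set.Ico c d)
      ⟨le_of_lt hcs, (show s < t from hs).trans_le h'⟩ _
  · refine ⟨0, ?_⟩
    filter_upwards [mem_nhdsWithin_of_mem_nhds (Ioi_mem_nhds h')] with s hs
    exact Set.indicator_of_notMem (fun hm => not_lt.2 (le_of_lt hs) hm.2) _

theorem continuousAt_indicator_Ico {E : Type*} [Zero E] [TopologicalSpace E] {c d t : ℝ} (w : E)
    (hc : t ≠ c) (hd : t ≠ d) : ContinuousAt ((Set.Ico c d).indicator fun _ => w) t := by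
  have key : ∀ᶠ s in 𝓝 t, (s ∈ Set.Ico c d ↔ t ∈ Set.Ico c d) := by
    rcases hc.lt_or_gt with h | h
    · filter_upwards [Iio_mem_nhds h] with s hs
      simp [not_le.2 h, not_le.2 (show s < c from hs)]
    rcases hd.lt_or_gt with h' | h'
    · filter_upwards [Iio_mem_nhds h', Ioi_mem_nhds h] with s hs hts
      simp [h.le, h', show s < d from hs, (show c < s from hts).le]
    · filter_upwards [Ioi_mem_nhds h'] with s hts
      simp [not_lt.2 h'.le, not_lt.2 (show d < s from hts).le]
  refine (continuousAt_const (y := (Set.Ico c d).indicator (fun _ => w) t)).congr ?_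
  filter_upwards [key] with s hs
  simp only [Set.indicator, hs]

theorem stepControl_right (c d : ι → ℝ) (w : ι → Fin m → ℝ) (t : ℝ) :
    ContinuousWithinAt (stepControl c d w) (Set.Ici t) t :=
  tendsto_finsetSum _ fun i _ =>
    (tendsto_const_nhds (x := (Set.Ico (c i) (d i)).indicator (fun _ => w i) t)).congr'
      (indicator_Ico_right (c i) (d i) t (w i)).symm

theorem isControl_stepControl (T : Set ℝ) (t₀ t₁ : ℝ) (c d : ι → ℝ) (w : ι → Fin m → ℝ) :
    IsControl T t₀ t₁ (stepControl c d w) := by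
  refine ⟨((Set.finite_range c).union (Set.finite_range d)).subset fun t ht => ?_,
    fun t ht _ => ⟨(stepControl_right c d w t).mono fun s hs => hs.2.1, ?_⟩⟩
  · by_contra hmem
    rw [Set.mem_union, not_or] at hmem
    refine ht.2 (ContinuousAt.continuousWithinAt ?_)
    exact tendsto_finsetSum _ fun i _ => continuousAt_indicator_Ico (w i)
      (fun h => hmem.1 ⟨i, h.symm⟩) fun h => hmem.2 ⟨i, h.symm⟩
  · choose l hl using fun i => exists_indicator_Ico_left (c i) (d i) t (w i)
    refine ⟨∑ i, l i, Tendsto.mono_left ?_ (nhdsWithin_mono t fun s hs => hs.2.2)⟩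
    exact tendsto_finsetSum _ fun i _ => tendsto_const_nhds.congr' (hl i).symm

theorem stepControl_nonneg (hw : ∀ i, 0 ≤ w i) (s : ℝ) : 0 ≤ stepControl c d w s :=
  Finset.sum_nonneg fun i _ => Set.indicator_nonneg (fun _ _ => hw i) s

theorem exists_isTrajectory_stepControl (hT : IsClosed T) (ht₀ : t₀ ∈ T)
    (A : Matrix (Fin n) (Fin n) ℝ) (B : Matrix (Fin n) (Fin m) ℝ) (c d : ι → ℝ)
    (w : ι → Fin m → ℝ) :
    ∃ x, IsTrajectory T A B t₀ t₁ (stepControl c d w) x ∧ x t₀ = 0 := by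
  refine exists_isTrajectory hT ht₀ A B (C := ∑ i, ‖w i‖) ?_ (fun s => ?_)
    fun t _ => (stepControl_right c d w t).mono fun s hs => hs.2.1
  · exact Finset.measurable_sum _ fun i _ => measurable_const.indicator measurableSet_Ico
  · exact (norm_sum_le _ _).trans (Finset.sum_le_sum fun i _ => norm_indicator_le_norm_self _ _)

end StepControl

/-- From the origin, under the constant unit input `k`, the initial forward derivative is column `k`
of `B`. It is a limit of nonnegative difference quotients. -/
theorem input_nonneg (hT : IsClosed T) (hpos : IsPositiveSystem T A B) (ht₀ : t₀ ∈ T)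
    (ht₁ : t₁ ∈ T) (h01 : t₀ < t₁) (i : Fin n) (k : Fin m) : 0 ≤ B i k := by
  have hw : (0 : Fin m → ℝ) ≤ Pi.single k 1 := Pi.single_nonneg.2 zero_le_one
  obtain ⟨x, hx, hx0⟩ := exists_isTrajectory_stepControl (t₁ := t₁) (ι := Unit) hT ht₀ A B
    (fun _ => t₀) (fun _ => t₁) (fun _ => Pi.single k 1)
  have hxnn := hpos t₀ ht₀ t₁ ht₁ _ x
    ⟨isControl_stepControl T t₀ t₁ _ _ _, fun s _ => stepControl_nonneg (fun _ => hw) s⟩ hx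
    hx0.ge
  have hd := hx.hasForwardDerivAt ht₁ ⟨ht₀, le_rfl, h01⟩ i
  have hval : (A *ᵥ x t₀ + B *ᵥ stepControl (fun _ : Unit => t₀) (fun _ => t₁)
      (fun _ => Pi.single k 1) t₀) i = B i k := by
    simp [hx0, stepControl, h01]
  rw [hval] at hd
  have hne := nextFilter_neBot ht₁ h01
  refine ge_of_tendsto hd ?_
  filter_upwards [eventually_nextFilter hT ht₁ h01] with s hs
  have h1 := hxnn s ⟨hs.1, hs.2.1.le, hs.2.2⟩ i
  simp only [hx0, Pi.zero_apply, sub_zero] at h1 ⊢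
  exact div_nonneg h1 (sub_nonneg.2 hs.2.1.le)

end TimeScale

/-! ### The Gram matrix and positive reachability. -/

namespace TimeScale

variable {T : Set ℝ} {n m : ℕ} {t₀ t₁ s t : ℝ} {A : Matrix (Fin n) (Fin n) ℝ}
  {B : Matrix (Fin n) (Fin m) ℝ}

theorem forwardJump_mem_Icc (hT : IsClosed T) (ht₁ : t₁ ∈ T) (ht : t ∈ Set.Ico t₀ t₁) :
    forwardJump T t ∈ T ∩ Set.Icc t₀ t₁ :=
  ⟨forwardJump_mem hT ⟨t₁, ht₁, ht.2⟩, ht.1.trans (le_forwardJump T t), forwardJump_le ht₁ ht.2⟩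

open MeasureTheory in
/-- The composition of a continuous function with the forward jump has an antiderivative. -/
theorem exists_isAntiderivOn_comp_forwardJump (hT : IsClosed T) (ht₁ : t₁ ∈ T) {G : ℝ → ℝ}
    (hG : ContinuousOn G (T ∩ Set.Icc t₀ t₁)) :
    ∃ F, IsAntiderivOn T (fun t => G (forwardJump T t)) t₀ t₁ F := by
  classical
  set S := T ∩ Set.Icc t₀ t₁
  have hS : IsClosed S := hT.inter isClosed_Icc
  have hcomp : IsCompact S := isCompact_Icc.inter_left hT
  obtain ⟨C, hC⟩ := hcomp.exists_bound_of_continuousOn hG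
  -- The jump operator, evaluated at all reals, is monotone and sends every point of a gap to the
  -- right end of that gap. So the integrand is measurable and already constant on gaps, without
  -- rounding to `T`.
  set q : ℝ → ℝ := fun r => S.indicator G (forwardJump T r) with hq
  have hqm : Measurable q := by
    have hg : Measurable (S.indicator G) := by
      rw [← Set.piecewise_eq_indicator]
      exact hG.measurable_piecewise continuousOn_const hS.measurableSet
    exact hg.comp (forwardJump_mono T).measurable
  have hqi : ∀ a b, IntervalIntegrable q volume a b := fun a b =>
    intervalIntegrable_of_norm_le (C := |C|) hqm.stronglyMeasurable fun r _ => by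
      by_cases h : forwardJump T r ∈ S
      · simp only [hq, Set.indicator_of_mem h]
        exact (hC _ h).trans (le_abs_self C)
      · simp [hq, Set.indicator_of_notMem h]
  refine ⟨fun s => ∫ r in t₀..s, q r,
    (intervalIntegral.continuous_primitive hqi t₀).continuousOn, fun t ht => ?_⟩
  have htS : t ∈ S := ⟨ht.1, ht.2.1, ht.2.2.le⟩
  have hj : forwardJump S t = forwardJump T t := forwardJump_congr ht₁ ht.2.2
    fun r hr hr' => ⟨fun h => h.1, fun h => ⟨h, ht.2.1.trans hr.le, hr'⟩⟩
  have hσ : forwardJump T t ∈ S := forwardJump_mem_Icc hT ht₁ ht.2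
  have hqt : q t = G (forwardJump T t) := Set.indicator_of_mem hσ G
  change HasDeltaDerivAt S _ (G (forwardJump T t)) t
  rw [← hqt]
  refine hasDeltaDerivAt_of_integral (C := 0) hS htS hqi (fun s _ => (zero_add _).symm)
    (fun r hr hr' => ?_) fun h0 ε hε => ?_
  · rw [hj] at hr'
    simp only [hq]
    rw [le_antisymm (forwardJump_le hσ.1 hr') (forwardJump_mono T hr.le)]
  · rw [hj] at h0
    obtain ⟨δ, hδ, H⟩ := Metric.continuousWithinAt_iff.1 (hG t htS) ε hε
    refine ⟨δ, hδ, fun s hs hst r hr => ?_⟩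
    have hmax : max s t ∈ S := by
      rcases max_choice s t with h | h <;> rw [h] <;> assumption
    have hr1 : r < t₁ := hr.2.trans_le hmax.2.2
    have hr0 : t₀ ≤ r := (le_min hs.2.1 ht.2.1).trans hr.1.le
    have hrS : forwardJump T r ∈ S := forwardJump_mem_Icc hT ht₁ ⟨hr0, hr1⟩
    rw [hqt, h0]
    simp only [hq, Set.indicator_of_mem hrS]
    refine (H hrS (lt_of_le_of_lt ?_ hst)).le
    rw [Real.dist_eq, abs_sub_comm, abs_sub_comm s]
    exact Set.abs_sub_right_of_mem_uIcc
      ⟨hr.1.le.trans (le_forwardJump T r), forwardJump_le hmax.1 hr.2⟩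

theorem IsAntiderivOn.hasForwardDerivAt {f F : ℝ → ℝ} (h : IsAntiderivOn T f t₀ t₁ F)
    (ht₁ : t₁ ∈ T) (ht : t ∈ T ∩ Set.Ico t₀ t₁) : HasForwardDerivAt T F (f t) t :=
  (h.2 t ht).hasForwardDerivAt ⟨ht.1, ht.2.1, ht.2.2.le⟩ ht₁ ht.2.2
    fun _ hr hr' => ⟨fun h => h.1, fun h => ⟨h, ht.2.1.trans hr.le, hr'⟩⟩

theorem deltaIntegral_eq_zero (hT : IsClosed T) (ht₀ : t₀ ∈ T) (ht₁ : t₁ ∈ T) (h01 : t₀ ≤ t₁)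
    {f : ℝ → ℝ} (hf : ∀ t ∈ T ∩ Set.Ico t₀ t₁, f t = 0) : deltaIntegral T f t₀ t₁ = 0 := by
  rw [deltaIntegral]
  split_ifs with h
  · have hF := h.choose_spec
    rw [eq_of_hasForwardDerivAt_zero hT ht₀ ht₁ h01 hF.1
      fun t ht => hf t ht ▸ hF.hasForwardDerivAt ht₁ ht, sub_self]
  · rfl

/-- Existence of an antiderivative matters, since otherwise `deltaIntegral` defaults to `0`. Any
antiderivative that the choice picks has a positive increment. -/
theorem deltaIntegral_pos (hT : IsClosed T) (ht₀ : t₀ ∈ T) (ht₁ : t₁ ∈ T)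
    {f : ℝ → ℝ} (hex : ∃ F, IsAntiderivOn T f t₀ t₁ F) (hf : ∀ t ∈ T ∩ Set.Ico t₀ t₁, 0 ≤ f t)
    (ht : t ∈ T ∩ Set.Ico t₀ t₁) (hft : 0 < f t) : 0 < deltaIntegral T f t₀ t₁ := by
  rw [deltaIntegral, dif_pos hex]
  have hF := hex.choose_spec
  exact sub_pos.2 (lt_of_hasForwardDerivAt hT ht₀ ht₁ hF.1 hf
    (fun t ht => hF.hasForwardDerivAt ht₁ ht) ht hft)

section Gram

variable {ι : Type*}

theorem continuousOn_matrixExp_mul (hT : IsClosed T) (ht₁ : t₁ ∈ T)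
    (A : Matrix (Fin n) (Fin n) ℝ) (C : Matrix (Fin n) ι ℝ) (i : Fin n) (k : ι) :
    ContinuousOn (fun s => (matrixExp T A t₁ s * C) i k) (T ∩ Set.Icc t₀ t₁) := by
  simp only [Matrix.mul_apply]
  exact continuousOn_finsetSum _ fun l _ => (continuousOn_matrixExp_left hT ht₁ A i l).mul_const _

/-- Positivity of `e_A(t₁, σ(τ)) C` persists to the right of `τ`. -/
theorem exists_Ico_matrixExp_mul_pos (hT : IsClosed T) (ht₁ : t₁ ∈ T) {C : Matrix (Fin n) ι ℝ}
    {τ : ℝ} (hτ : τ ∈ T ∩ Set.Ico t₀ t₁) {i : Fin n} {k : ι}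
    (hpos : 0 < (matrixExp T A t₁ (forwardJump T τ) * C) i k) :
    ∃ τ' > τ, ∀ s ∈ T ∩ Set.Ico t₀ t₁, s ∈ Set.Ico τ τ' →
      0 < (matrixExp T A t₁ (forwardJump T s) * C) i k := by
  rcases (le_forwardJump T τ).eq_or_lt with h0 | h0
  · rw [← h0] at hpos
    have hG := continuousOn_matrixExp_mul (t₀ := t₀) hT ht₁ A C i k τ ⟨hτ.1, hτ.2.1, hτ.2.2.le⟩
    obtain ⟨δ, hδ, H⟩ := Metric.mem_nhdsWithin_iff.1 (hG (Ioi_mem_nhds hpos))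
    have hlt : forwardJump T τ < τ + δ := by linarith
    -- Taking `τ'` in `T` keeps `σ(s) ≤ τ'` for `s < τ'`, so the jump cannot leave the neighbourhood
    -- where positivity holds.
    obtain ⟨τ', hτ', hττ', hτ'δ⟩ : ∃ τ' ∈ T, τ < τ' ∧ τ' < τ + δ := by
      rw [forwardJump, if_pos ⟨t₁, ht₁, hτ.2.2⟩] at hlt
      obtain ⟨r, hr, hrδ⟩ := exists_lt_of_csInf_lt (s := {s | s ∈ T ∧ τ < s})
        ⟨t₁, ht₁, hτ.2.2⟩ hlt
      exact ⟨r, hr.1, hr.2, hrδ⟩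
    refine ⟨τ', hττ', fun s hs hsI => ?_⟩
    have h1 := forwardJump_le hτ' hsI.2
    have h2 := le_forwardJump T s
    have h3 := hsI.1
    refine H ⟨?_, forwardJump_mem_Icc hT ht₁ hs.2⟩
    rw [Metric.mem_ball, Real.dist_eq, abs_lt]
    constructor <;> linarith
  -- At a right-scattered `τ` the only scale point of `[τ, σ(τ))` is `τ`.
  · refine ⟨forwardJump T τ, h0, fun s hs hsI => ?_⟩
    have : s = τ := by
      by_contra hne
      exact absurd (forwardJump_le hs.1 (lt_of_le_of_ne hsI.1 (Ne.symm hne))) (not_le.2 hsI.2)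
    rwa [this]

variable [Fintype ι]

theorem gram_integrand_apply (E : Matrix (Fin n) (Fin n) ℝ) (C : Matrix (Fin n) ι ℝ)
    (i j : Fin n) : (E * C * Cᵀ * Eᵀ) i j = ∑ k, (E * C) i k * (E * C) j k := by
  rw [Matrix.mul_assoc (E * C), ← Matrix.transpose_mul, Matrix.mul_apply]
  rfl

/-- When the columns of `e_A(t₁, σ(s)) C` are nonnegative and the Gram matrix is monomial, every
coordinate vector is reached from some time on through some column, up to a positive factor, and
such a column contributes to no other coordinate. -/
theorem exists_column_of_isMonomialMatrix (hT : IsClosed T) (ht₀ : t₀ ∈ T) (ht₁ : t₁ ∈ T)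
    (h01 : t₀ < t₁) {C : Matrix (Fin n) ι ℝ}
    (hnn : ∀ s ∈ T ∩ Set.Ico t₀ t₁, ∀ i k, 0 ≤ (matrixExp T A t₁ (forwardJump T s) * C) i k)
    (hW : IsMonomialMatrix (gramMatrix T A C t₀ t₁)) (i : Fin n) :
    ∃ k, ∃ τ ∈ T ∩ Set.Ico t₀ t₁, 0 < (matrixExp T A t₁ (forwardJump T τ) * C) i k ∧
      ∀ s ∈ T ∩ Set.Ico t₀ t₁, ∀ j, j ≠ i →
        (matrixExp T A t₁ (forwardJump T s) * C) i k *
          (matrixExp T A t₁ (forwardJump T s) * C) j k = 0 := by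
  set Φ : ℝ → Matrix (Fin n) ι ℝ := fun s => matrixExp T A t₁ (forwardJump T s) * C with hΦ
  have hWdef : ∀ i j, gramMatrix T A C t₀ t₁ i j =
      deltaIntegral T (fun s => ∑ k, Φ s i k * Φ s j k) t₀ t₁ := by
    intro i j
    simp only [gramMatrix, Matrix.of_apply, gram_integrand_apply, hΦ]
  have hint : ∀ i j, ∃ F, IsAntiderivOn T (fun s => ∑ k, Φ s i k * Φ s j k) t₀ t₁ F := fun i j =>
    exists_isAntiderivOn_comp_forwardJump (G := fun s =>
      ∑ k, (matrixExp T A t₁ s * C) i k * (matrixExp T A t₁ s * C) j k) hT ht₁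
      (continuousOn_finsetSum _ fun k _ => (continuousOn_matrixExp_mul hT ht₁ A C i k).mul
        (continuousOn_matrixExp_mul hT ht₁ A C j k))
  have hterm : ∀ i j, ∀ s ∈ T ∩ Set.Ico t₀ t₁, ∀ k, 0 ≤ Φ s i k * Φ s j k := fun i j s hs k =>
    mul_nonneg (hnn s hs i k) (hnn s hs j k)
  have hWpos : ∀ i j, ∀ s ∈ T ∩ Set.Ico t₀ t₁, ∀ k, Φ s i k * Φ s j k ≠ 0 →
      0 < gramMatrix T A C t₀ t₁ i j := by
    intro i j s hs k hk
    rw [hWdef]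
    refine deltaIntegral_pos hT ht₀ ht₁ (hint i j)
      (fun r hr => Finset.sum_nonneg fun k _ => hterm i j r hr k) hs ?_
    exact Finset.sum_pos' (fun k _ => hterm i j s hs k)
      ⟨k, Finset.mem_univ k, lt_of_le_of_ne (hterm i j s hs k) hk.symm⟩
  obtain ⟨j₀, hj₀, hzero⟩ := hW.1 i
  obtain ⟨τ, hτ, k, hk⟩ : ∃ τ ∈ T ∩ Set.Ico t₀ t₁, ∃ k, Φ τ i k * Φ τ j₀ k ≠ 0 := by
    by_contra! hc
    have : gramMatrix T A C t₀ t₁ i j₀ = 0 := by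
      rw [hWdef]
      exact deltaIntegral_eq_zero hT ht₀ ht₁ h01.le
        fun s hs => Finset.sum_eq_zero fun k _ => hc s hs k
    exact hj₀.ne' this
  have hik : Φ τ i k ≠ 0 := left_ne_zero_of_mul hk
  -- A nonzero `Φ τ i k` makes the diagonal entry positive, so the unique positive entry of row `i`
  -- is the diagonal one.
  have hij₀ : i = j₀ := by
    by_contra hne
    exact (hWpos i i τ hτ k (mul_ne_zero hik hik)).ne' (hzero i hne)
  refine ⟨k, τ, hτ, lt_of_le_of_ne (hnn τ hτ i k) hik.symm, fun s hs j hj => ?_⟩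
  by_contra hne
  exact (hWpos i j s hs k hne).ne' (hzero j (hij₀ ▸ hj))

/-- A positive system is positively reachable when the Gram matrix of a family of columns of its
input matrix is monomial. -/
theorem positivelyReachableOn_of_isMonomialMatrix (hT : IsClosed T)
    (hpos : IsPositiveSystem T A B) (ht₀ : t₀ ∈ T) (ht₁ : t₁ ∈ T) (h01 : t₀ < t₁) (κ : ι → Fin m)
    (hW : IsMonomialMatrix (gramMatrix T A (B.submatrix id κ) t₀ t₁)) :
    PositivelyReachableOn T A B t₀ t₁ := by
  set Φ : ℝ → Matrix (Fin n) ι ℝ := fun s => matrixExp T A t₁ (forwardJump T s) *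
    B.submatrix id κ with hΦ
  have hnn : ∀ s ∈ T ∩ Set.Ico t₀ t₁, ∀ i k, 0 ≤ Φ s i k := by
    intro s hs i k
    have hσ := forwardJump_mem_Icc hT ht₁ hs.2
    simp only [hΦ, Matrix.mul_apply]
    exact Finset.sum_nonneg fun l _ => mul_nonneg
      (matrixExp_nonneg hT hpos hσ.1 ht₁ hσ.2.2 i l) (input_nonneg hT hpos ht₀ ht₁ h01 l (κ k))
  choose k τ hτ hΦτ hΦz using exists_column_of_isMonomialMatrix hT ht₀ ht₁ h01 hnn hW
  choose τ' hττ' hτ' using fun i => exists_Ico_matrixExp_mul_pos hT ht₁ (hτ i) (hΦτ i)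
  -- Pulse `i` uses only the input that serves coordinate `i`, with height `c i`. The intervals of
  -- different pulses may overlap.
  set w : (Fin n → ℝ) → Fin n → Fin m → ℝ := fun c i => c i • Pi.single (κ (k i)) 1 with hw
  have htraj := fun c => exists_isTrajectory_stepControl (t₁ := t₁) hT ht₀ A B τ τ' (w c)
  choose x hx hx0 using htraj
  set ψ : Fin n → ℝ → ℝ := fun i s => (Set.Ico (τ i) (τ' i)).indicator (fun _ => Φ s i (k i)) s
    with hψ
  have hψnn : ∀ i, ∀ s ∈ T ∩ Set.Ico t₀ t₁, 0 ≤ ψ i s := fun i s hs =>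
    Set.indicator_nonneg (fun _ _ => hnn s hs i (k i)) s
  have hp : ∀ c i, ∀ s ∈ T ∩ Set.Ico t₀ t₁,
      HasForwardDerivAt T (fun r => (matrixExp T A t₁ r *ᵥ x c r) i) (c i * ψ i s) s := by
    intro c j s hs
    have h1 := (hx c).hasForwardDerivAt_matrixExp_mulVec hT ht₁ hs j
    convert h1 using 1
    have hsingle : ∀ i, (matrixExp T A t₁ (forwardJump T s) *ᵥ (B *ᵥ
        (Set.Ico (τ i) (τ' i)).indicator (fun _ => w c i) s)) j =
        (Set.Ico (τ i) (τ' i)).indicator (fun _ => c i * Φ s j (k i)) s := by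
      intro i
      by_cases hsi : s ∈ Set.Ico (τ i) (τ' i)
      · rw [Set.indicator_of_mem hsi, Set.indicator_of_mem hsi, hw]
        simp only [Matrix.mulVec_smul, Matrix.mulVec_single_one, Pi.smul_apply, smul_eq_mul]
        rfl
      · rw [Set.indicator_of_notMem hsi, Set.indicator_of_notMem hsi, Matrix.mulVec_zero,
          Matrix.mulVec_zero, Pi.zero_apply]
    rw [stepControl, Matrix.mulVec_sum, Matrix.mulVec_sum, Finset.sum_apply]
    simp only [hsingle]
    -- Pulse `i ≠ j` does not act on coordinate `j`: while it is on, `Φ s i (k i) > 0`, and the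
    -- vanishing product forces `Φ s j (k i) = 0`.
    rw [Finset.sum_eq_single j (fun i _ hij => ?_) (fun h => absurd (Finset.mem_univ j) h)]
    · by_cases hsj : s ∈ Set.Ico (τ j) (τ' j)
      · simp only [hψ, Set.indicator_of_mem hsj]
      · simp only [hψ, Set.indicator_of_notMem hsj, mul_zero]
    · by_cases hsi : s ∈ Set.Ico (τ i) (τ' i)
      · rw [Set.indicator_of_mem hsi]
        rcases mul_eq_zero.1 (hΦz i s hs j hij.symm) with h | h
        · exact absurd h (hτ' i s hs hsi).ne'
        · simp only [hΦ, h, mul_zero]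
      · rw [Set.indicator_of_notMem hsi]
  have hpc : ∀ c i, ContinuousOn (fun r => (matrixExp T A t₁ r *ᵥ x c r) i)
      (T ∩ Set.Icc t₀ t₁) := fun c i => continuousOn_matrixExp_mulVec_trajectory hT ht₁ (hx c).1 i
  have hp0 : ∀ c i, (matrixExp T A t₁ t₀ *ᵥ x c t₀) i = 0 := fun c i => by
    rw [hx0, Matrix.mulVec_zero, Pi.zero_apply]
  have hp1 : ∀ c i, (matrixExp T A t₁ t₁ *ᵥ x c t₁) i = x c t₁ i := fun c i => by
    rw [matrixExp_self hT ht₁, Matrix.one_mulVec]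
  have hgain : ∀ i, 0 < x 1 t₁ i := by
    intro i
    rw [← hp1, ← hp0 1 i]
    refine lt_of_hasForwardDerivAt (f := fun r => (matrixExp T A t₁ r *ᵥ x 1 r) i)
      (d := ψ i) hT ht₀ ht₁ (hpc 1 i) (hψnn i)
      (fun s hs => by simpa using hp 1 i s hs) (hτ i) ?_
    have hψτ : ψ i (τ i) = Φ (τ i) i (k i) :=
      Set.indicator_of_mem (s := Set.Ico (τ i) (τ' i)) ⟨le_rfl, hττ' i⟩ _
    rw [hψτ]
    exact hΦτ i
  -- Both sides, pulled forward to `t₁` by the matrix exponential, start at zero and have the same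
  -- derivative `c i * ψ i`.
  have hlin : ∀ c i, x c t₁ i = c i * x 1 t₁ i := by
    intro c i
    have := eq_of_hasForwardDerivAt_zero (f := fun r => (matrixExp T A t₁ r *ᵥ x c r) i -
        c i * (matrixExp T A t₁ r *ᵥ x 1 r) i) hT ht₀ ht₁ h01.le
      ((hpc c i).sub (continuousOn_const.mul (hpc 1 i)))
      (fun s hs => by simpa using (hp c i s hs).sub ((hp 1 i s hs).const_mul (c i)))
    simp only [hp0, hp1] at this
    linarith
  refine Set.Subset.antisymm ?_ fun z hz => ?_
  · rintro z ⟨u, y, hu, hy, hy0, rfl⟩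
    exact hpos t₀ ht₀ t₁ ht₁ u y hu hy hy0.ge t₁ ⟨ht₁, h01.le, le_rfl⟩
  · set c : Fin n → ℝ := fun i => z i / x 1 t₁ i with hc
    refine ⟨_, x c, ⟨isControl_stepControl T t₀ t₁ τ τ' (w c), fun s _ =>
      stepControl_nonneg (fun i => ?_) s⟩, hx c, hx0 c, ?_⟩
    · exact smul_nonneg (div_nonneg (hz i) (hgain i).le) (Pi.single_nonneg.2 zero_le_one)
    · ext i
      rw [hlin, hc]
      exact div_mul_cancel₀ _ (hgain i).ne'

end Gram

end TimeScale

theorem mainTheorem9 (T : Set ℝ) (hT : IsClosed T) {n m : ℕ}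
    (A : Matrix (Fin n) (Fin n) ℝ) (B : Matrix (Fin n) (Fin m) ℝ)
    (hpos : TimeScale.IsPositiveSystem T A B)
    (t₀ t₁ : ℝ) (ht₀ : t₀ ∈ T) (ht₁ : t₁ ∈ T) (h01 : t₀ < t₁) :
    ((∃ M : Finset (Fin m), TimeScale.IsMonomialMatrix
        (TimeScale.gramMatrix T A (TimeScale.columns B M) t₀ t₁)) →
      TimeScale.PositivelyReachableOn T A B t₀ t₁) ∧
    (TimeScale.IsMonomialMatrix (TimeScale.gramMatrix T A B t₀ t₁) →
      TimeScale.PositivelyReachableOn T A B t₀ t₁) :=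
  ⟨fun ⟨_, hM⟩ => TimeScale.positivelyReachableOn_of_isMonomialMatrix hT hpos ht₀ ht₁ h01 _ hM,
    fun hW => TimeScale.positivelyReachableOn_of_isMonomialMatrix hT hpos ht₀ ht₁ h01 id hW⟩
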